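/- Let $p$ be a prime, let $\mathcal F$ be a saturated fusion system over a finite $p$-group $S$, and let $\mathcal F^c$ be the set of $\mathcal F$-centric subgroups of $S$, i.e. of the $P\le S$ such that $C_S(Q)\le Q$ for each $Q$ that is $\mathcal F$-conjugate to $P$. Let $\mathcal X\subseteq\mathcal F^c$ be a nonempty family of subgroups that is closed under $\mathcal F$-conjugacy and overgroups. Let $\mathcal F^{\mathcal X}\subseteq\mathcal F$ be the full subcategory with object set $\mathcal X$, and let $\mathcal T^{\mathcal X}(S)$ be the category with object set $\mathcal X$ and morphism sets $T_S(P,Q)=\{g\in S: gPg^{-1}\le Q\}$. An *$\mathcal X$-linking system* associated to $\mathcal F$ is a category $\mathcal L$ with object set $\mathcal X$, together with functors $\pi\colon\mathcal L\to\mathcal F^{\mathcal X}$ and $\delta\colon\mathcal T^{\mathcal X}(S)\to\mathcal L$ that are the identity on objects, such that for all $P,Q\in\mathcal X$: (A) $\pi$ is surjective on morphisms, $Z(P)$ acts freely on $\mathrm{Mor}_{\mathcal L}(P,Q)$ by composition (via $\delta_P$), and $\pi$ induces a bijection $\mathrm{Mor}_{\mathcal L}(P,Q)/Z(P)\cong\mathrm{Hom}_{\mathcal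 F}(P,Q)$; (B) $\pi(\delta_{P,Q}(g))=c_g=(x\mapsto gxg^{-1})$ for $g\in T_S(P,Q)$; (C) $f\circ\delta_P(g)=\delta_Q(\pi(f)(g))\circ f$ for $f\in\mathrm{Mor}_{\mathcal L}(P,Q)$ and $g\in P$. Two such systems are isomorphic if there is an isomorphism of categories between them that commutes with the functors $\pi$ and $\delta$. Let $\mathrm{Link}_{\mathcal F}^{\mathcal X}$ be the set of isomorphism classes of $\mathcal X$-linking systems associated to $\mathcal F$. Let $\mathcal O(\mathcal F^c)$ be the category with object set $\mathcal F^c$ and with $\mathrm{Mor}(P,Q)=Q\backslash\mathrm{Hom}_{\mathcal F}(P,Q)$, where $Q$ acts by post-composition with conjugations. Let $\mathcal Z=\mathcal Z_{\mathcal F}^{\mathcal X}\colon\mathcal O(\mathcal F^c)^{\mathrm{op}}\to\mathrm{Ab}$ be the functor with $\mathcal Z(P)=Z(P)$ for $P\in\mathcal X$ and $\mathcal Z(P)=0$ for $P\notin\mathcal X$, which for $P,Q\in\mathcal X$ sends the class of $\varphi\colon P\to Q$ to $\varphi^{-1}\colon Z(Q)\to Z(P)$. Let $\lim^i$ be the $i$-th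 right derived functor of the inverse limit of functors $\mathcal O(\mathcal F^c)^{\mathrm{op}}\to\mathrm{Ab}$. For $i=2,3$ the group $\lim^i\mathcal Z$ is isomorphic to the $i$-th cohomology group of the bar complex $C^n=\prod_{P_0\to\cdots\to P_n}\mathcal Z(P_0)$ with its usual coboundary; fix such isomorphisms (the following holds for every choice of them), and write $[z]\in\lim^i\mathcal Z$ for the class of a cocycle $z$. **(a)** Choose a representative $\sigma(f)\in\mathrm{Hom}_{\mathcal F}(P,Q)$ for each morphism $f\colon P\to Q$ of $\mathcal O(\mathcal F^c)$, and for each pair $P\xrightarrow{f}Q\xrightarrow{g}R$ an element $t(f,g)\in R$ with $\sigma(g)\circ\sigma(f)=c_{t(f,g)}\circ\sigma(gf)$. Let $u\in C^3$ be such that, for each $P\xrightarrow{f}Q\xrightarrow{g}R\xrightarrow{h}T$ with $P\in\mathcal X$, $$\sigma(h)(t(f,g))\cdot t(gf,h)=t(g,h)\cdot t(f,hg)\cdot\sigma(hgf)(u(f,g,h)).$$ Such $\sigma$, $t$, $u$ exist, $u$ is always a cocycle, and its class $o=[u]\in\lim^3\mathcal Z$ does not depend on the choices. The set $\mathrm{Link}_{\mathcal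 F}^{\mathcal X}$ is nonempty if and only if $o=0$. In particular, $\mathrm{Link}_{\mathcal F}^{\mathcal X}\neq\emptyset$ whenever $\lim^3\mathcal Z=0$. **(b)** If $\mathrm{Link}_{\mathcal F}^{\mathcal X}\neq\emptyset$, then the group $\lim^2\mathcal Z$ acts freely and transitively on $\mathrm{Link}_{\mathcal F}^{\mathcal X}$, and hence the two sets have the same cardinality. In this action, for a $2$-cocycle $z$ and linking systems $\mathcal L,\mathcal L'$ (with structural functors $\pi,\delta$ and $\pi',\delta'$), $[z]$ sends the class of $\mathcal L$ to that of $\mathcal L'$ if and only if there are maps $\theta\colon\mathrm{Mor}_{\mathcal L}(P,Q)\to\mathrm{Mor}_{\mathcal L'}(P,Q)$, for $P,Q\in\mathcal X$, with $\pi'(\theta(f))=\pi(f)$, with $\theta(f\circ\delta_P(a))=\theta(f)\circ\delta'_P(a)$ for $a\in P$, and with $$\theta(g\circ f)=\theta(g)\circ\theta(f)\circ\delta'_P(z([\pi(f)],[\pi(g)]))$$ for all $P\xrightarrow{f}Q\xrightarrow{g}R$ in $\mathcal L$. -/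

import Mathlib

open CategoryTheory Opposite

universe u

/-! ### Fusion systems -/

section Transporter

variable {S : Type u} [Group S]

/-- The transporter set `T_S(P, Q)` of all `g : S` with `g P g⁻¹ ≤ Q`. -/
def transporter (P Q : Subgroup S) : Set S :=
  {g | ∀ x ∈ P, g * x * g⁻¹ ∈ Q}

theorem one_mem_transporter (P : Subgroup S) : (1 : S) ∈ transporter P P := by
  intro x hx
  simpa using hx

theorem mul_mem_transporter {P Q R : Subgroup S} {g h : S}
    (hg : g ∈ transporter P Q) (hh : h ∈ transporter Q R) : h * g ∈ transporter P R := by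
  intro x hx
  have := hh _ (hg x hx)
  simpa [mul_assoc] using this

theorem mem_transporter_self {P : Subgroup S} {g : S} (hg : g ∈ P) : g ∈ transporter P P :=
  fun _ hx => P.mul_mem (P.mul_mem hg hx) (P.inv_mem hg)

/-- Left conjugation `c_g : P → Q`, `x ↦ g x g⁻¹`, for `g ∈ T_S(P, Q)`. -/
def conjHom {P Q : Subgroup S} (g : transporter P Q) : P →* Q where
  toFun x := ⟨g.1 * x.1 * g.1⁻¹, g.2 x.1 x.2⟩
  map_one' := by ext; simp
  map_mul' x y := by ext; simp [mul_assoc]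

end Transporter

/-- A fusion system over the group `S`: a category whose objects are the subgroups of `S`, whose
morphisms are injective homomorphisms (with the usual composition), which contains all
homomorphisms induced by conjugation in `S`, and in which each morphism is an isomorphism
of the category followed by an inclusion. -/
structure FusionSystem (S : Type u) [Group S] where
  Hom (P Q : Subgroup S) : Set (P →* Q)
  injective {P Q : Subgroup S} {φ : P →* Q} : φ ∈ Hom P Q → Function.Injective φ
  conj_mem {P Q : Subgroup S} (g : transporter P Q) : conjHom g ∈ Hom P Q
  comp_mem {P Q R : Subgroup S} {φ : P →* Q} {ψ : Q →* R} :
    φ ∈ Hom P Q → ψ ∈ Hom Q R → ψ.comp φ ∈ Hom P R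
  exists_factor {P Q : Subgroup S} {φ : P →* Q} : φ ∈ Hom P Q →
    ∃ (R : Subgroup S) (hR : R ≤ Q) (e : P ≃* R),
      e.toMonoidHom ∈ Hom P R ∧ e.symm.toMonoidHom ∈ Hom R P ∧
        φ = (Subgroup.inclusion hR).comp e.toMonoidHom

namespace FusionSystem

variable {S : Type u} [Group S] (F : FusionSystem S)

theorem id_mem (P : Subgroup S) : MonoidHom.id P ∈ F.Hom P P := by
  have h : conjHom (⟨1, one_mem_transporter P⟩ : transporter P P) = MonoidHom.id P := by
    ext x
    simp [conjHom]
  exact h ▸ F.conj_mem _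

/-- `P` and `Q` are `F`-conjugate: they are isomorphic in the category `F`. -/
def Conj (P Q : Subgroup S) : Prop :=
  ∃ e : P ≃* Q, e.toMonoidHom ∈ F.Hom P Q ∧ e.symm.toMonoidHom ∈ F.Hom Q P

/-- The set `F^c` of `F`-centric subgroups of `S`. -/
def centric : Set (Subgroup S) :=
  {P | ∀ Q, F.Conj P Q → Subgroup.centralizer (Q : Set S) ≤ Q}

/-- `Aut_F(P)`, as a group of automorphisms of `P`. -/
def autGroup (P : Subgroup S) : Subgroup (MulAut P) where
  carrier := {α | MulEquiv.toMonoidHom α ∈ F.Hom P P ∧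
    MulEquiv.toMonoidHom (MulEquiv.symm α) ∈ F.Hom P P}
  one_mem' := ⟨F.id_mem P, F.id_mem P⟩
  mul_mem' := fun ha hb => ⟨F.comp_mem hb.1 ha.1, F.comp_mem ha.2 hb.2⟩
  inv_mem' := fun ha => ⟨ha.2, ha.1⟩

end FusionSystem

/-- `Aut_S(P)`: the automorphisms of `P` induced by conjugation by elements of `N_S(P)`. -/
def autS {S : Type u} [Group S] (P : Subgroup S) : Subgroup (MulAut P) :=
  P.normalizerMonoidHom.range

/-- For an isomorphism `φ : Q → P`, the subgroup
`N_φ = {g ∈ N_S(Q) | φ c_g φ⁻¹ ∈ Aut_S(P)}` of `S`. -/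
def extensionDomain {S : Type u} [Group S] {Q P : Subgroup S} (φ : Q ≃* P) : Subgroup S :=
  ((autS P).comap
    ((MulAut.congr φ).toMonoidHom.comp Q.normalizerMonoidHom)).map
      (Subgroup.normalizer (Q : Set S)).subtype

namespace FusionSystem

variable {S : Type u} [Group S] (F : FusionSystem S)

/-- `P` is fully automized: `Aut_S(P)` is a Sylow `p`-subgroup of `Aut_F(P)`. -/
def FullyAutomized (p : ℕ) (P : Subgroup S) : Prop :=
  ∃ A : Sylow p (F.autGroup P), (A : Subgroup (F.autGroup P)) = (autS P).subgroupOf (F.autGroup P)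

/-- `P` is receptive: each isomorphism `φ ∈ Iso_F(Q, P)` extends to a morphism `N_φ → S` in `F`. -/
def Receptive (P : Subgroup S) : Prop :=
  ∀ (Q : Subgroup S) (φ : Q ≃* P), φ.toMonoidHom ∈ F.Hom Q P → φ.symm.toMonoidHom ∈ F.Hom P Q →
    ∃ ψ ∈ F.Hom (extensionDomain φ) ⊤,
      ∀ (x : S) (hx : x ∈ Q) (hx' : x ∈ extensionDomain φ),
        (ψ ⟨x, hx'⟩ : S) = (φ ⟨x, hx⟩ : S)

/-- `F` is saturated: each subgroup of `S` is `F`-conjugate to one which is fully automized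
and receptive. -/
def IsSaturated (p : ℕ) : Prop :=
  ∀ P : Subgroup S, ∃ Q : Subgroup S, F.Conj P Q ∧ F.FullyAutomized p Q ∧ F.Receptive Q

/-- `X` is a family of `F`-centric subgroups closed under `F`-conjugacy and overgroups. -/
structure IsClosedFamily (X : Set (Subgroup S)) : Prop where
  centric : X ⊆ F.centric
  conj_mem : ∀ P ∈ X, ∀ Q, F.Conj P Q → Q ∈ X
  overgroup_mem : ∀ P ∈ X, ∀ Q, P ≤ Q → Q ∈ X

/-- Identity morphisms of the category `F`. -/
def homId (P : Subgroup S) : F.Hom P P := ⟨MonoidHom.id P, F.id_mem P⟩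

/-- `φ.homComp ψ` is `φ` followed by `ψ`, in the category `F`. -/
def homComp {P Q R : Subgroup S} (φ : F.Hom P Q) (ψ : F.Hom Q R) : F.Hom P R :=
  ⟨ψ.1.comp φ.1, F.comp_mem φ.2 ψ.2⟩

/-- The morphism `c_g` of `F`, for `g ∈ T_S(P, Q)`. -/
def homConj {P Q : Subgroup S} (g : transporter P Q) : F.Hom P Q := ⟨conjHom g, F.conj_mem g⟩

/-! ### Linking systems -/

/-- An `X`-linking system associated to `F`: a category with object set `X`, with functors
`π` to `F^X` and `δ` from the transporter category `T^X(S)`, both the identity on objects.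
Here `comp f f'` is `f` followed by `f'`. -/
structure LinkingSystem (X : Set (Subgroup S)) where
  /-- the category -/
  Mor : X → X → Type u
  id (P : X) : Mor P P
  comp {P Q R : X} : Mor P Q → Mor Q R → Mor P R
  id_comp {P Q : X} (f : Mor P Q) : comp (id P) f = f
  comp_id {P Q : X} (f : Mor P Q) : comp f (id Q) = f
  assoc {P Q R T : X} (f : Mor P Q) (g : Mor Q R) (h : Mor R T) :
    comp (comp f g) h = comp f (comp g h)
  /-- the functor `π` -/
  π {P Q : X} : Mor P Q → F.Hom P.1 Q.1
  π_id (P : X) : π (id P) = F.homId P.1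
  π_comp {P Q R : X} (f : Mor P Q) (g : Mor Q R) : π (comp f g) = F.homComp (π f) (π g)
  /-- the functor `δ` -/
  δ {P Q : X} : transporter P.1 Q.1 → Mor P Q
  δ_one (P : X) : δ ⟨1, one_mem_transporter P.1⟩ = id P
  δ_mul {P Q R : X} (g : transporter P.1 Q.1) (h : transporter Q.1 R.1) :
    δ ⟨h.1 * g.1, mul_mem_transporter g.2 h.2⟩ = comp (δ g) (δ h)
  /-- (A): `π` is surjective on morphisms -/
  π_surjective {P Q : X} : Function.Surjective (π : Mor P Q → F.Hom P.1 Q.1)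
  /-- (A): `Z(P)` acts freely on `Mor P Q` -/
  free {P Q : X} (f : Mor P Q) (z : P.1) (hz : z ∈ Subgroup.center P.1) :
    comp (δ ⟨z.1, mem_transporter_self z.2⟩) f = f → z = 1
  /-- (A): `π` induces a bijection from `Mor P Q / Z(P)` to `Hom_F(P, Q)` -/
  π_eq_iff {P Q : X} (f f' : Mor P Q) :
    π f = π f' ↔ ∃ z : P.1, z ∈ Subgroup.center P.1 ∧
      f' = comp (δ ⟨z.1, mem_transporter_self z.2⟩) f
  /-- (B) -/
  π_δ {P Q : X} (g : transporter P.1 Q.1) : π (δ g) = F.homConj g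
  /-- (C) -/
  δ_comp {P Q : X} (f : Mor P Q) (g : P.1) :
    comp (δ ⟨g.1, mem_transporter_self g.2⟩) f =
      comp f (δ ⟨((π f).1 g).1, mem_transporter_self ((π f).1 g).2⟩)

namespace LinkingSystem

variable {F} {X : Set (Subgroup S)}

/-- The automorphism `δ_P(g)` of `P`, for `g ∈ P`. -/
def δSelf (L : F.LinkingSystem X) (P : X) (g : P.1) : L.Mor P P :=
  L.δ ⟨g.1, mem_transporter_self g.2⟩

/-- Isomorphism of linking systems: an isomorphism of categories that commutes with the structural
functors `π` and `δ` (hence is the identity on objects). -/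
def Iso (L L' : F.LinkingSystem X) : Prop :=
  ∃ Ψ : ∀ P Q : X, L.Mor P Q ≃ L'.Mor P Q,
    (∀ P, Ψ P P (L.id P) = L'.id P) ∧
    (∀ (P Q R : X) (f : L.Mor P Q) (g : L.Mor Q R),
      Ψ P R (L.comp f g) = L'.comp (Ψ P Q f) (Ψ Q R g)) ∧
    (∀ (P Q : X) (f : L.Mor P Q), L'.π (Ψ P Q f) = L.π f) ∧
    (∀ (P Q : X) (g : transporter P.1 Q.1), Ψ P Q (L.δ g) = L'.δ g)

variable (F X) in
/-- The setoid on linking systems given by isomorphism. -/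
def isoSetoid : Setoid (F.LinkingSystem X) where
  r := Iso
  iseqv :=
    { refl := fun L => ⟨fun _ _ => Equiv.refl _, by simp, by simp, by simp, by simp⟩
      symm := by
        rintro L L' ⟨Ψ, h1, h2, h3, h4⟩
        refine ⟨fun P Q => (Ψ P Q).symm, ?_, ?_, ?_, ?_⟩
        · intro P
          rw [Equiv.symm_apply_eq, h1]
        · intro P Q R f g
          rw [Equiv.symm_apply_eq, h2]
          simp
        · intro P Q f
          rw [← h3]
          simp
        · intro P Q g
          rw [Equiv.symm_apply_eq, h4]
      trans := by
        rintro L L' L'' ⟨Ψ, h1, h2, h3, h4⟩ ⟨Ψ', h1', h2', h3', h4'⟩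
        refine ⟨fun P Q => (Ψ P Q).trans (Ψ' P Q), ?_, ?_, ?_, ?_⟩
        · intro P
          simp [h1, h1']
        · intro P Q R f g
          simp [h2, h2']
        · intro P Q f
          simp [h3, h3']
        · intro P Q g
          simp [h4, h4'] }

end LinkingSystem

/-- The set of isomorphism classes of `X`-linking systems associated to `F`. -/
def LinkingClasses (X : Set (Subgroup S)) : Type (u + 1) :=
  Quotient (LinkingSystem.isoSetoid F X)

/-- The isomorphism class of a linking system. -/
def LinkingSystem.toClass {F : FusionSystem S} {X : Set (Subgroup S)} (L : F.LinkingSystem X) :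
    F.LinkingClasses X :=
  Quotient.mk (LinkingSystem.isoSetoid F X) L

/-! ### The orbit category -/

/-- `Q` acts on `Hom_F(P, Q)` by post-composition with inner automorphisms. -/
def orbitSetoid (P Q : Subgroup S) : Setoid (F.Hom P Q) where
  r φ ψ := ∃ q : Q, ∀ x, ψ.1 x = q * φ.1 x * q⁻¹
  iseqv :=
    { refl := fun φ => ⟨1, by simp⟩
      symm := by
        rintro φ ψ ⟨q, hq⟩
        exact ⟨q⁻¹, fun x => by rw [hq]; group⟩
      trans := by
        rintro φ ψ χ ⟨q, hq⟩ ⟨r, hr⟩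
        exact ⟨r * q, fun x => by rw [hr, hq]; group⟩ }

/-- Objects of the full subcategory, with object set `Y`, of the orbit category of `F`. -/
structure OrbitCategory {S : Type u} [Group S] (F : FusionSystem S) (Y : Set (Subgroup S)) :
    Type u where
  obj : Subgroup S
  mem : obj ∈ Y

/-- Morphisms from `P` to `Q` in the orbit category: the set `Q \ Hom_F(P, Q)`. -/
instance {Y : Set (Subgroup S)} : Category.{u} (F.OrbitCategory Y) where
  Hom P Q := Quotient (F.orbitSetoid P.obj Q.obj)
  id P := Quotient.mk _ (F.homId P.obj)
  comp {P Q R} f g := Quotient.map₂ (sa := F.orbitSetoid P.obj Q.obj)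
    (sb := F.orbitSetoid Q.obj R.obj) (sc := F.orbitSetoid P.obj R.obj)
    (fun φ ψ => F.homComp φ ψ) (by
      rintro φ φ' ⟨q, hq⟩ ψ ψ' ⟨r, hr⟩
      refine ⟨r * ψ.1 q, fun x => ?_⟩
      simp only [homComp, MonoidHom.comp_apply, hq, hr, map_mul, map_inv]
      group) f g
  id_comp f := by
    induction f using Quotient.inductionOn
    rfl
  comp_id f := by
    induction f using Quotient.inductionOn
    rfl
  assoc f g h := by
    induction f using Quotient.inductionOn
    induction g using Quotient.inductionOn
    induction h using Quotient.inductionOn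
    rfl

/-- The class in the orbit category of a morphism of `F`. -/
def orbitClass {Y : Set (Subgroup S)} {P Q : F.OrbitCategory Y} (φ : F.Hom P.obj Q.obj) : P ⟶ Q :=
  Quotient.mk (F.orbitSetoid P.obj Q.obj) φ

/-! ### The functor `Z_F^X` -/

/-- The group `Z(P)` if `P ∈ X`, and the trivial group otherwise. -/
def centerOn (X : Set (Subgroup S)) (P : Subgroup S) : Subgroup P where
  carrier := {z | z ∈ Subgroup.center P ∧ (P ∉ X → z = 1)}
  one_mem' := ⟨Subgroup.one_mem _, fun _ => rfl⟩
  mul_mem' := fun ha hb => ⟨Subgroup.mul_mem _ ha.1 hb.1, fun h => by simp [ha.2 h, hb.2 h]⟩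
  inv_mem' := fun ha => ⟨Subgroup.inv_mem _ ha.1, fun h => by simp [ha.2 h]⟩

instance (X : Set (Subgroup S)) (P : Subgroup S) : CommGroup (centerOn X P) where
  mul_comm a b := Subtype.ext (Subgroup.mem_center_iff.mp b.2.1 a.1)

variable {F} {X : Set (Subgroup S)}

theorem centerOn_ext {P : Subgroup S} {w w' : centerOn X P} (h : P ∈ X → w.1 = w'.1) : w = w' := by
  by_cases hP : P ∈ X
  · exact Subtype.ext (h hP)
  · exact Subtype.ext ((w.2.2 hP).trans (w'.2.2 hP).symm)

/-- The preimage under a morphism `φ : P → Q` in `F` of a central element of `Q`. -/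
theorem exists_centerOn_map (hX : F.IsClosedFamily X) {P Q : F.OrbitCategory F.centric}
    (f : P ⟶ Q) (z : centerOn X Q.obj) :
    ∃ w : centerOn X P.obj, P.obj ∈ X →
      ∀ φ : F.Hom P.obj Q.obj, F.orbitClass φ = f → φ.1 w.1 = z.1 := by
  induction f using Quotient.inductionOn with
  | h φ =>
  by_cases hP : P.obj ∈ X
  swap
  · exact ⟨1, fun h => absurd h hP⟩
  obtain ⟨R, hR, e, he, he', hφ⟩ := F.exists_factor φ.2
  have hc := hX.centric hP R ⟨e, he, he'⟩
  have hz : (z.1.1 : S) ∈ R := by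
    apply hc
    rw [Subgroup.mem_centralizer_iff]
    intro x hx
    exact congrArg Subtype.val (Subgroup.mem_center_iff.mp z.2.1 ⟨x, hR hx⟩)
  have hw : φ.1 (e.symm ⟨z.1.1, hz⟩) = z.1 := by
    rw [hφ]
    ext
    simp
  refine ⟨⟨e.symm ⟨z.1.1, hz⟩, ?_, fun h => absurd hP h⟩, fun _ ψ hψ => ?_⟩
  · rw [Subgroup.mem_center_iff]
    intro x
    apply F.injective φ.2
    rw [map_mul, map_mul, hw]
    exact Subgroup.mem_center_iff.mp z.2.1 _
  · obtain ⟨q, hq⟩ := Quotient.exact hψ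
    have h1 := hw.symm.trans (hq (e.symm ⟨z.1.1, hz⟩))
    have h2 : ψ.1 (e.symm ⟨z.1.1, hz⟩) = q⁻¹ * (z.1 * q) := by
      refine Eq.trans ?_ (congrArg (fun y => q⁻¹ * (y * q)) h1).symm
      group
    refine h2.trans ?_
    rw [← Subgroup.mem_center_iff.mp z.2.1 q]
    group

/-- The homomorphism `φ⁻¹ : Z(Q) → Z(P)` induced by the class of `φ` (trivial if `P ∉ X`). -/
noncomputable def centerOnMap (hX : F.IsClosedFamily X) {P Q : F.OrbitCategory F.centric}
    (f : P ⟶ Q) (z : centerOn X Q.obj) : centerOn X P.obj :=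
  (exists_centerOn_map hX f z).choose

theorem centerOnMap_spec (hX : F.IsClosedFamily X) {P Q : F.OrbitCategory F.centric}
    (φ : F.Hom P.obj Q.obj) (z : centerOn X Q.obj) (hP : P.obj ∈ X) :
    φ.1 (centerOnMap hX (F.orbitClass φ : P ⟶ Q) z).1 = z.1 :=
  (exists_centerOn_map hX (F.orbitClass φ : P ⟶ Q) z).choose_spec hP φ rfl

theorem centerOnMap_eq (hX : F.IsClosedFamily X) {P Q : F.OrbitCategory F.centric}
    (φ : F.Hom P.obj Q.obj) (z : centerOn X Q.obj) (w : centerOn X P.obj)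
    (h : P.obj ∈ X → φ.1 w.1 = z.1) : centerOnMap hX (F.orbitClass φ : P ⟶ Q) z = w :=
  centerOn_ext fun hP => F.injective φ.2 ((centerOnMap_spec hX φ z hP).trans (h hP).symm)

theorem mem_of_hom (hX : F.IsClosedFamily X) {P Q : Subgroup S} (φ : F.Hom P Q) (hP : P ∈ X) :
    Q ∈ X := by
  obtain ⟨R, hR, e, he, he', -⟩ := F.exists_factor φ.2
  exact hX.overgroup_mem R (hX.conj_mem P hP R ⟨e, he, he'⟩) Q hR

theorem centerOnMap_mul (hX : F.IsClosedFamily X) {P Q : F.OrbitCategory F.centric}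
    (f : P ⟶ Q) (a b : centerOn X Q.obj) :
    centerOnMap hX f (a * b) = centerOnMap hX f a * centerOnMap hX f b := by
  obtain ⟨φ, rfl⟩ := Quotient.exists_rep f
  refine centerOnMap_eq hX φ _ _ fun hP => ?_
  have ha := centerOnMap_spec hX φ a hP
  have hb := centerOnMap_spec hX φ b hP
  exact (map_mul φ.1 _ _).trans (congrArg₂ (· * ·) ha hb)

theorem centerOnMap_id (hX : F.IsClosedFamily X) (P : F.OrbitCategory F.centric)
    (a : centerOn X P.obj) : centerOnMap hX (𝟙 P) a = a :=
  centerOnMap_eq hX (F.homId P.obj) _ _ fun _ => rfl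

theorem centerOnMap_comp (hX : F.IsClosedFamily X) {P Q R : F.OrbitCategory F.centric}
    (f : P ⟶ Q) (g : Q ⟶ R) (a : centerOn X R.obj) :
    centerOnMap hX (f ≫ g) a = centerOnMap hX f (centerOnMap hX g a) := by
  obtain ⟨φ, rfl⟩ := Quotient.exists_rep f
  obtain ⟨ψ, rfl⟩ := Quotient.exists_rep g
  refine centerOnMap_eq hX (F.homComp φ ψ) _ _ fun hP => ?_
  have h1 := centerOnMap_spec hX φ (centerOnMap hX (F.orbitClass ψ : Q ⟶ R) a) hP
  have h2 := centerOnMap_spec hX ψ a (mem_of_hom hX φ hP)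
  exact (congrArg ψ.1 h1).trans h2

/-- The functor `Z_F^X : O(F^c)ᵒᵖ → Ab`, which sends `P` to `Z(P)` if `P ∈ X` and to `0` if
`P ∉ X`, and sends the class of `φ : P → Q` to `φ⁻¹ : Z(Q) → Z(P)` for `P, Q ∈ X`. -/
noncomputable def centerFunctor (hX : F.IsClosedFamily X) :
    (F.OrbitCategory F.centric)ᵒᵖ ⥤ AddCommGrpCat.{u} where
  obj P := AddCommGrpCat.of (Additive (centerOn X P.unop.obj))
  map f := AddCommGrpCat.ofHom (MonoidHom.toAdditive
    (MonoidHom.mk' (centerOnMap hX f.unop) (centerOnMap_mul hX f.unop)))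
  map_id P := AddCommGrpCat.hom_ext (AddMonoidHom.ext fun z =>
    congrArg Additive.ofMul (centerOnMap_id hX P.unop (Additive.toMul z)))
  map_comp g f := AddCommGrpCat.hom_ext (AddMonoidHom.ext fun z =>
    congrArg Additive.ofMul (centerOnMap_comp hX f.unop g.unop (Additive.toMul z)))

/-- The element of `P` underlying an element of `Z_F^X(P)`. -/
def centerVal {hX : F.IsClosedFamily X} {P : F.OrbitCategory F.centric}
    (z : (centerFunctor hX).obj (op P)) : P.obj :=
  ((Additive.toMul (α := centerOn X P.obj) z : centerOn X P.obj) : P.obj)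

end FusionSystem

/-! ### Higher limits -/

namespace HigherLimits

section Derived

variable (C : Type u) [SmallCategory C]

instance isGrothendieckAbelian_presheaf :
    IsGrothendieckAbelian.{u} (Cᵒᵖ ⥤ AddCommGrpCat.{u}) :=
  IsGrothendieckAbelian.of_equivalence (sheafBotEquivalence AddCommGrpCat.{u})

instance lim_additive :
    (Limits.lim : (Cᵒᵖ ⥤ AddCommGrpCat.{u}) ⥤ AddCommGrpCat.{u}).Additive :=
  Functor.additive_of_preserves_binary_products _

variable {C}

/-- `lim^n(G)`: the `n`-th right derived functor of the inverse limit, for contravariant functors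
on `C`. -/
noncomputable def higherLim (n : ℕ) (G : Cᵒᵖ ⥤ AddCommGrpCat.{u}) : AddCommGrpCat.{u} :=
  ((Limits.lim : (Cᵒᵖ ⥤ AddCommGrpCat.{u}) ⥤ AddCommGrpCat.{u}).rightDerived n).obj G

end Derived

section Bar

variable {C : Type u} [SmallCategory C] (G : Cᵒᵖ ⥤ AddCommGrpCat.{u})

/-- `1`-cochains: functions sending `P ⟶ Q` to an element of `G(P)`. -/
abbrev Cochain₁ : Type u := ∀ P Q : C, (P ⟶ Q) → G.obj (op P)

/-- `2`-cochains: functions sending `P ⟶ Q ⟶ R` to an element of `G(P)`. -/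
abbrev Cochain₂ : Type u := ∀ P Q R : C, (P ⟶ Q) → (Q ⟶ R) → G.obj (op P)

/-- `3`-cochains. -/
abbrev Cochain₃ : Type u :=
  ∀ P Q R T : C, (P ⟶ Q) → (Q ⟶ R) → (R ⟶ T) → G.obj (op P)

/-- `4`-cochains. -/
abbrev Cochain₄ : Type u :=
  ∀ P Q R T U : C, (P ⟶ Q) → (Q ⟶ R) → (R ⟶ T) → (T ⟶ U) → G.obj (op P)

/-- The coboundary from `1`-cochains to `2`-cochains. -/
def d₁ : Cochain₁ G →+ Cochain₂ G where
  toFun c P Q R f g := G.map f.op (c Q R g) - c P R (f ≫ g) + c P Q f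
  map_zero' := by
    funext P Q R f g
    simp
  map_add' c c' := by
    funext P Q R f g
    simp only [Pi.add_apply, map_add]
    abel

/-- The coboundary from `2`-cochains to `3`-cochains. -/
def d₂ : Cochain₂ G →+ Cochain₃ G where
  toFun c P Q R T f g h :=
    G.map f.op (c Q R T g h) - c P R T (f ≫ g) h + c P Q T f (g ≫ h) - c P Q R f g
  map_zero' := by
    funext P Q R T f g h
    simp
  map_add' c c' := by
    funext P Q R T f g h
    simp only [Pi.add_apply, map_add]
    abel

/-- The coboundary from `3`-cochains to `4`-cochains. -/
def d₃ : Cochain₃ G →+ Cochain₄ G where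
  toFun c P Q R T U f g h k :=
    G.map f.op (c Q R T U g h k) - c P R T U (f ≫ g) h k + c P Q T U f (g ≫ h) k
      - c P Q R U f g (h ≫ k) + c P Q R T f g h
  map_zero' := by
    funext P Q R T U f g h k
    simp
  map_add' c c' := by
    funext P Q R T U f g h k
    simp only [Pi.add_apply, map_add]
    abel

/-- The group of `2`-cocycles. -/
abbrev Cocycle₂ : AddSubgroup (Cochain₂ G) := (d₂ G).ker

/-- The group of `3`-cocycles. -/
abbrev Cocycle₃ : AddSubgroup (Cochain₃ G) := (d₃ G).ker

/-- The second cohomology group of the bar complex of `G`: cocycles modulo coboundaries. -/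
abbrev BarH₂ : Type u := Cocycle₂ G ⧸ (d₁ G).range.addSubgroupOf (Cocycle₂ G)

/-- The third cohomology group of the bar complex of `G`: cocycles modulo coboundaries. -/
abbrev BarH₃ : Type u := Cocycle₃ G ⧸ (d₂ G).range.addSubgroupOf (Cocycle₃ G)

variable {G}

/-- The class of a `2`-cocycle. -/
def class₂ (z : Cocycle₂ G) : BarH₂ G := QuotientAddGroup.mk z

/-- The class of a `3`-cocycle. -/
def class₃ (z : Cocycle₃ G) : BarH₃ G := QuotientAddGroup.mk z

end Bar

end HigherLimits

/-! ### The obstruction cocycle and the twisting of linking systems -/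

namespace FusionSystem

open HigherLimits

variable {S : Type u} [Group S] {F : FusionSystem S} {X : Set (Subgroup S)}

/-- `u` is an obstruction cochain for the existence of an `X`-linking system. There are
* a choice `σ(f)`, for each morphism `f` of `O(F^c)`, of a morphism of `F` in the class `f`, and
* elements `t(f, g) ∈ R`, for each `P --f--> Q --g--> R` in `O(F^c)`, such that
  `σ(g) ∘ σ(f) = c_{t(f, g)} ∘ σ(g ∘ f)`,

and `u` measures the failure of associativity of the multiplication on the sets
`Q × Mor_{O(F^c)}(P, Q)` defined by these choices: if `P --f--> Q --g--> R --h--> T` with `P ∈ X`,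
then `u(f, g, h) ∈ Z(P)` is the element for which
`σ(h)(t(f, g)) t(g ∘ f, h) = t(g, h) t(f, h ∘ g) σ(h ∘ g ∘ f)(u(f, g, h))`.
(For `P ∉ X`, `u(f, g, h)` lies in the zero group `Z_F^X(P)`.) -/
def IsObstructionCochain (hX : F.IsClosedFamily X) (u : Cochain₃ (centerFunctor hX)) : Prop :=
  ∃ (σ : ∀ P Q : F.OrbitCategory F.centric, (P ⟶ Q) → F.Hom P.obj Q.obj)
    (t : ∀ P Q R : F.OrbitCategory F.centric, (P ⟶ Q) → (Q ⟶ R) → R.obj),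
    (∀ P Q f, F.orbitClass (σ P Q f) = f) ∧
    (∀ P Q R f g (x : P.obj),
      (σ Q R g).1 ((σ P Q f).1 x) =
        t P Q R f g * (σ P R (f ≫ g)).1 x * (t P Q R f g)⁻¹) ∧
    (∀ P Q R T f g h, P.obj ∈ X →
      (σ R T h).1 (t P Q R f g) * t P R T (f ≫ g) h =
        t Q R T g h * t P Q T f (g ≫ h) *
          (σ P T (f ≫ g ≫ h)).1 (centerVal (u P Q R T f g h)))

/-- The object of `O(F^c)` given by a member of `X`. -/
def IsClosedFamily.toOrbit (hX : F.IsClosedFamily X) (P : X) : F.OrbitCategory F.centric :=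
  ⟨P.1, hX.centric P.2⟩

/-- The class in `O(F^c)` of (the image under `π` of) a morphism of a linking system. -/
def LinkingSystem.orbitMor (L : F.LinkingSystem X) (hX : F.IsClosedFamily X) {P Q : X}
    (f : L.Mor P Q) : hX.toOrbit P ⟶ hX.toOrbit Q :=
  F.orbitClass (P := hX.toOrbit P) (Q := hX.toOrbit Q) (L.π f)

/-- `L'` is a twist of the linking system `L` by the `2`-cochain `z`: up to maps `θ` between the
morphism sets, which commute with `π` and with the action of `P` on the morphisms out of `P`, the
composition in `L` is the composition in `L'` multiplied by `z`, that is
`θ(g ∘ f) = θ(g) ∘ θ(f) ∘ δ'_P(z([f], [g]))` for `P --f--> Q --g--> R` in `L`. -/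
def IsTwist (hX : F.IsClosedFamily X) (z : Cochain₂ (centerFunctor hX))
    (L L' : F.LinkingSystem X) : Prop :=
  ∃ θ : ∀ P Q : X, L.Mor P Q → L'.Mor P Q,
    (∀ (P Q : X) (f : L.Mor P Q), L'.π (θ P Q f) = L.π f) ∧
    (∀ (P Q : X) (a : P.1) (f : L.Mor P Q),
      θ P Q (L.comp (L.δSelf P a) f) = L'.comp (L'.δSelf P a) (θ P Q f)) ∧
    (∀ (P Q R : X) (f : L.Mor P Q) (g : L.Mor Q R),
      θ P R (L.comp f g) =
        L'.comp (L'.δSelf P (centerVal (z (hX.toOrbit P) (hX.toOrbit Q) (hX.toOrbit R)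
          (L.orbitMor hX f) (L.orbitMor hX g)))) (L'.comp (θ P Q f) (θ Q R g)))

end FusionSystem

open FusionSystem HigherLimits

/-!
The bar complex is exact in its coefficient functor and its cohomology in degree `0` is the inverse
limit. Every functor `G` embeds in the coinduced functor `P ↦ ∏_{Q → P} G(Q)`, on which the bar
complex has a contracting homotopy; an injective functor is a retract of a coinduced one, hence
acyclic. By dimension shifting the bar complex therefore computes the derived functors of the limit.

Choosing lifts of the orbit morphisms to a linking system identifies its morphism sets with
`Q × Mor(P, Q)`, where the composition is given by representatives `σ` and conjugating elements `t`.
Conversely, such a composition is associative exactly when the defect `u` of `t` vanishes, and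
multiplying `t` by central elements changes `u` by an arbitrary coboundary. Likewise, multiplying
the composition of a linking system by a `2`-cocycle gives another one, any two linking systems
differ by such a twist, and the twist gives an isomorphic linking system exactly for coboundaries.
-/

namespace HigherLimits

/-! ### Derived functors from effaceable complexes -/

section Acyclic

open Limits

universe v v' w w'

variable {𝒜 : Type w} [Category.{v} 𝒜] [Abelian 𝒜] {ℬ : Type w'} [Category.{v'} ℬ] [Abelian ℬ]

/-- The homology of `X₁ ⟶ Z ⊆ X₂ ⟶ X₃`, where `Z` is the kernel of the second map. -/
noncomputable def homologyIsoOfFactorization {T : ShortComplex ℬ} {Z H : ℬ} {i : Z ⟶ T.X₂}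
    {wi : i ≫ T.g = 0} (hi : IsLimit (KernelFork.ofι i wi)) {p : T.X₁ ⟶ Z} (hp : p ≫ i = T.f)
    {q : Z ⟶ H} {wq : p ≫ q = 0} (hq : IsColimit (CokernelCofork.ofπ q wq)) :
    T.homology ≅ H := by
  have hlift : hi.lift (KernelFork.ofι T.f T.zero) = p :=
    Fork.IsLimit.hom_ext hi ((hi.fac _ WalkingParallelPair.zero).trans hp.symm)
  subst hlift
  exact (ShortComplex.LeftHomologyData.mk Z H i q wi hi wq hq).homologyIso

/-- The short complex `Zⁿ → Iⁿ → Zⁿ⁺¹` formed by a cochain complex `I` and its cocycles. -/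
noncomputable def cocyclesShortComplex (I : CochainComplex 𝒜 ℕ) (n : ℕ) : ShortComplex 𝒜 where
  X₁ := kernel (I.d n (n + 1))
  X₂ := I.X n
  X₃ := kernel (I.d (n + 1) (n + 2))
  f := kernel.ι _
  g := kernel.lift _ (I.d n (n + 1)) (I.d_comp_d _ _ _)
  zero := by simp [← cancel_mono (kernel.ι _)]

theorem cocyclesShortComplex_shortExact {I : CochainComplex 𝒜 ℕ} {n : ℕ}
    (hI : I.ExactAt (n + 1)) : (cocyclesShortComplex I n).ShortExact where
  exact := ShortComplex.exact_of_f_is_kernel _ <|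
    isKernelOfComp _ (I.d n (n + 1)) (kernelIsKernel _) (cocyclesShortComplex I n).zero
      (kernel.lift_ι _ _ _)
  mono_f := by unfold cocyclesShortComplex; infer_instance
  epi_g := ((I.exactAt_iff' n (n + 1) (n + 2) (by simp) (by simp)).mp hI).epi_kernelLift

/-- The kernel of `I⁰ → I¹` is the object resolved by `I`. -/
noncomputable def kernelZeroIso {G : 𝒜} (I : InjectiveResolution G) :
    kernel (I.cocomplex.d 0 1) ≅ G :=
  (kernelIsKernel _).conePointUniqueUpToIso I.isLimitKernelFork

/-- A functor to cochain complexes which, like the standard complexes computing derived functors,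
preserves short exact sequences and sends injective objects to complexes without cohomology in
positive degrees. -/
structure IsEffaceableComplex (K : 𝒜 ⥤ CochainComplex ℬ ℕ) [K.PreservesZeroMorphisms] : Prop where
  shortExact_map {S : ShortComplex 𝒜} : S.ShortExact → (S.map K).ShortExact
  isZero_homology (I : 𝒜) [Injective I] (n : ℕ) : IsZero ((K.obj I).homology (n + 1))

namespace IsEffaceableComplex

variable {K : 𝒜 ⥤ CochainComplex ℬ ℕ} [K.PreservesZeroMorphisms] (hK : IsEffaceableComplex K)
include hK

/-- The degree shift `Hⁿ⁺¹(K(Zᵐ⁺¹)) ≅ Hⁿ⁺²(K(Zᵐ))`. -/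
noncomputable def cocyclesShift {G : 𝒜} (I : InjectiveResolution G) (m n : ℕ) :
    (K.obj (kernel (I.cocomplex.d (m + 1) (m + 2)))).homology (n + 1) ≅
      (K.obj (kernel (I.cocomplex.d m (m + 1)))).homology (n + 2) :=
  (hK.shortExact_map (cocyclesShortComplex_shortExact (I.cocomplex_exactAt_succ m))).δIso
    (n + 1) (n + 2) rfl (hK.isZero_homology (I.cocomplex.X m) n)
    (hK.isZero_homology (I.cocomplex.X m) (n + 1))

theorem nonempty_iso_cocycles {G : 𝒜} (I : InjectiveResolution G) (n : ℕ) :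
    ∀ m, Nonempty ((K.obj (kernel (I.cocomplex.d (m + n) (m + n + 1)))).homology 1 ≅
      (K.obj (kernel (I.cocomplex.d m (m + 1)))).homology (n + 1)) := by
  induction n with
  | zero => exact fun m => ⟨Iso.refl _⟩
  | succ n ih =>
    intro m
    obtain ⟨e⟩ := ih (m + 1)
    rw [← Nat.add_right_comm] at e
    exact ⟨e ≪≫ hK.cocyclesShift I m n⟩

variable {F : 𝒜 ⥤ ℬ} [F.Additive] [PreservesFiniteLimits F]
  (e : F ≅ K ⋙ HomologicalComplex.homologyFunctor ℬ _ 0)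

/-- For an injective complex `I` exact at `n + 1`, the homology of `F(I)` at `n + 1` is the cokernel
of `F(Iⁿ) → F(Zⁿ⁺¹)`, which the connecting homomorphism identifies with `H¹(K(Zⁿ))`. -/
noncomputable def homologyMapIso (I : CochainComplex 𝒜 ℕ) (n : ℕ) [Injective (I.X n)]
    (hI : I.ExactAt (n + 1)) :
    ((I.sc' n (n + 1) (n + 2)).map F).homology ≅ (K.obj (kernel (I.d n (n + 1)))).homology 1 := by
  let S := cocyclesShortComplex I n
  have hS : (S.map K).ShortExact := hK.shortExact_map (cocyclesShortComplex_shortExact hI)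
  let δ : (K.obj S.X₃).homology 0 ⟶ (K.obj S.X₁).homology 1 := hS.δ 0 1 rfl
  let ε (A : 𝒜) : F.obj A ≅ (K.obj A).homology 0 := e.app A
  let π : F.obj S.X₃ ⟶ (K.obj S.X₁).homology 1 := (ε S.X₃).hom ≫ δ
  have hε : F.map S.g ≫ (ε S.X₃).hom =
      (ε S.X₂).hom ≫ HomologicalComplex.homologyMap (K.map S.g) 0 := e.hom.naturality S.g
  have hδ : HomologicalComplex.homologyMap (K.map S.g) 0 ≫ δ = 0 := hS.comp_δ 0 1 rfl
  have hπ : F.map S.g ≫ π = 0 := by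
    simp only [π, reassoc_of% hε, hδ, comp_zero]
  have hexact : (ShortComplex.mk (F.map S.g) π hπ).Exact :=
    (ShortComplex.exact_iff_of_iso (S₁ := ShortComplex.mk (F.map S.g) π hπ)
      (S₂ := ShortComplex.mk _ δ hδ)
      (ShortComplex.isoMk (ε S.X₂) (ε S.X₃) (Iso.refl _) hε.symm
        (Category.comp_id π).symm)).mpr (hS.homology_exact₃ 0 1 rfl)
  have : Epi δ := hS.epi_δ 0 1 rfl (hK.isZero_homology (I.X n) 0)
  have : Epi π := epi_comp _ _
  let Z := KernelFork.ofι _ (kernel.condition (I.d (n + 1) (n + 2)))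
  exact homologyIsoOfFactorization (T := (I.sc' n (n + 1) (n + 2)).map F)
    (wi := (Z.map F).condition) (Z.mapIsLimit (kernelIsKernel _) F)
    ((F.map_comp _ _).symm.trans (congrArg F.map (kernel.lift_ι _ _ _))) hexact.gIsCokernel

include e in
theorem nonempty_rightDerived_iso [EnoughInjectives 𝒜] (G : 𝒜) (n : ℕ) :
    Nonempty ((F.rightDerived (n + 1)).obj G ≅ (K.obj G).homology (n + 1)) := by
  let I := injectiveResolution G
  obtain ⟨shift⟩ := hK.nonempty_iso_cocycles I n 0
  rw [zero_add] at shift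
  let FI := (F.mapHomologicalComplex (ComplexShape.up ℕ)).obj I.cocomplex
  exact ⟨I.isoRightDerivedObj F (n + 1) ≪≫
    ShortComplex.homologyMapIso (FI.isoSc' n (n + 1) (n + 2) (by simp) (by simp)) ≪≫
    hK.homologyMapIso e I.cocomplex n (I.cocomplex_exactAt_succ n) ≪≫ shift ≪≫
    (HomologicalComplex.homologyFunctor ℬ _ (n + 1)).mapIso (K.mapIso (kernelZeroIso I))⟩

end IsEffaceableComplex

end Acyclic

/-! ### The bar complex -/

section BarComplex

variable {C : Type u} [SmallCategory C]

/-- Strings `P ⟶ P₁ ⟶ ⋯ ⟶ Pₙ` of `n` composable morphisms starting at `P`. -/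
inductive Strings : ℕ → C → Type u
  | nil (P : C) : Strings 0 P
  | cons {n : ℕ} {P Q : C} (f : P ⟶ Q) (s : Strings n Q) : Strings (n + 1) P

open Strings

section InnerCobd

variable {A B : Type*} [AddCommGroup A] [AddCommGroup B]

/-- The part of the bar coboundary, up to sign, that does not change the initial object of strings:
the alternating sum over the ways of composing two consecutive morphisms of a string or dropping the
last one. -/
def innerCobd : ∀ {n : ℕ} {P : C}, (Strings n P → A) → Strings (n + 1) P → A
  | 0, P, c, _ => c (nil P)
  | _ + 1, _, c, cons f (cons g s) =>
    c (cons (f ≫ g) s) - innerCobd (fun t => c (cons f t)) (cons g s)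

theorem innerCobd_comp (φ : A →+ B) {n : ℕ} {P : C} (c : Strings n P → A)
    (s : Strings (n + 1) P) : innerCobd (fun t => φ (c t)) s = φ (innerCobd c s) := by
  induction n generalizing P with
  | zero => rfl
  | succ n ih =>
    obtain _ | ⟨f, _ | ⟨g, s⟩⟩ := s
    simp only [innerCobd, ih, map_sub]

theorem innerCobd_sub {n : ℕ} {P : C} (c c' : Strings n P → A) (s : Strings (n + 1) P) :
    innerCobd (fun t => c t - c' t) s = innerCobd c s - innerCobd c' s := by
  induction n generalizing P with
  | zero => rfl
  | succ n ih =>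
    obtain _ | ⟨f, _ | ⟨g, s⟩⟩ := s
    simp only [innerCobd, ih]
    abel

theorem innerCobd_innerCobd {n : ℕ} {P : C} (c : Strings n P → A) (s : Strings (n + 2) P) :
    innerCobd (innerCobd c) s = 0 := by
  induction n generalizing P with
  | zero =>
    obtain _ | ⟨f, _ | ⟨g, s⟩⟩ := s
    exact sub_self _
  | succ n ih =>
    obtain _ | @⟨_, _, Q, f, _ | ⟨g, _ | ⟨h, s⟩⟩⟩ := s
    let face : Strings (n + 1) Q → A := fun | cons g' s' => c (cons (f ≫ g') s')
    have hface : (fun t => innerCobd c (cons f t)) =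
        fun t => face t - innerCobd (fun t => c (cons f t)) t := by
      funext t
      obtain _ | ⟨g', s'⟩ := t
      rfl
    rw [innerCobd, hface, innerCobd_sub, ih, sub_zero]
    simp only [innerCobd, face, Category.assoc, sub_self]

end InnerCobd

/-- The bar cochains of degree `n`: functions sending `P₀ ⟶ ⋯ ⟶ Pₙ` to an element of `G(P₀)`. -/
abbrev BarCochain (n : ℕ) (G : Cᵒᵖ ⥤ AddCommGrpCat.{u}) : Type u :=
  ∀ P : C, Strings n P → G.obj (op P)

variable (G : Cᵒᵖ ⥤ AddCommGrpCat.{u})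

/-- The coboundary of the bar complex. -/
def barCobd (n : ℕ) : BarCochain n G →+ BarCochain (n + 1) G :=
  AddMonoidHom.ofMapSub
    (fun c P s => match s with
      | cons (Q := Q) f s => G.map f.op (c Q s) - innerCobd (c P) (cons f s))
    fun c c' => by
      funext P s
      obtain _ | ⟨f, s⟩ := s
      have h := innerCobd_sub (c P) (c' P) (cons f s)
      simp only [Pi.sub_apply, map_sub, Pi.sub_def] at h ⊢
      rw [h]
      abel

variable {G}

theorem barCobd_cons {n : ℕ} (c : BarCochain n G) {P Q : C} (f : P ⟶ Q) (s : Strings n Q) :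
    barCobd G n c P (cons f s) = G.map f.op (c Q s) - innerCobd (c P) (cons f s) :=
  rfl

theorem barCobd_barCobd {n : ℕ} (c : BarCochain n G) : barCobd G (n + 1) (barCobd G n c) = 0 := by
  funext P s
  obtain _ | @⟨_, _, Q, f, _ | @⟨_, _, R, g, s⟩⟩ := s
  have hinner : innerCobd (fun t => barCobd G n c P (cons f t)) (cons g s) =
      G.map f.op (innerCobd (c Q) (cons g s)) -
        innerCobd (fun t => innerCobd (c P) (cons f t)) (cons g s) :=
    (innerCobd_sub _ _ _).trans (congrArg (· - _) (innerCobd_comp (G.map f.op).hom _ _))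
  have hzero := innerCobd_innerCobd (c P) (cons f (cons g s))
  have hcomp : G.map (f ≫ g).op (c R s) = G.map f.op (G.map g.op (c R s)) := by simp
  rw [innerCobd, sub_eq_zero] at hzero
  rw [barCobd_cons, innerCobd, hinner, barCobd_cons, barCobd_cons, map_sub, hcomp, hzero]
  simp only [Pi.zero_apply]
  abel

/-- The map of bar cochains induced by a natural transformation. -/
def mapBarCochain {G G' : Cᵒᵖ ⥤ AddCommGrpCat.{u}} (α : G ⟶ G') (n : ℕ) :
    BarCochain n G →+ BarCochain n G' :=
  AddMonoidHom.mk' (fun c P s => α.app (op P) (c P s)) fun _ _ => by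
    funext P s
    exact map_add (α.app (op P)).hom _ _

theorem barCobd_mapBarCochain {G G' : Cᵒᵖ ⥤ AddCommGrpCat.{u}} (α : G ⟶ G') {n : ℕ}
    (c : BarCochain n G) :
    barCobd G' n (mapBarCochain α n c) = mapBarCochain α (n + 1) (barCobd G n c) := by
  funext P s
  obtain _ | @⟨_, _, Q, f, s⟩ := s
  have hinner : innerCobd (mapBarCochain α n c P) (cons f s) =
      α.app (op P) (innerCobd (c P) (cons f s)) := innerCobd_comp (α.app (op P)).hom _ _
  have hnat : G'.map f.op (α.app (op Q) (c Q s)) = α.app (op P) (G.map f.op (c Q s)) :=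
    (NatTrans.naturality_apply α f.op (c Q s)).symm
  rw [barCobd_cons, hinner]
  exact (congrArg (· - _) hnat).trans (map_sub (α.app (op P)).hom _ _).symm

/-- The bar complex of `G`, as a functor of `G`. -/
def barComplex : (Cᵒᵖ ⥤ AddCommGrpCat.{u}) ⥤ CochainComplex AddCommGrpCat.{u} ℕ where
  obj G := CochainComplex.of (fun n => AddCommGrpCat.of (BarCochain n G))
    (fun n => AddCommGrpCat.ofHom (barCobd G n))
    (fun n => AddCommGrpCat.hom_ext (AddMonoidHom.ext barCobd_barCobd))
  map {G G'} α := CochainComplex.ofHom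
    (fun n => AddCommGrpCat.ofHom (mapBarCochain α n))
    (fun n => by
      dsimp only [CochainComplex.of]
      rw [CochainComplex.of_d, CochainComplex.of_d]
      exact AddCommGrpCat.hom_ext (AddMonoidHom.ext (barCobd_mapBarCochain α)))

theorem barComplex_obj_d (G : Cᵒᵖ ⥤ AddCommGrpCat.{u}) (n : ℕ) :
    (barComplex.obj G).d n (n + 1) = AddCommGrpCat.ofHom (barCobd G n) :=
  CochainComplex.of_d _ (fun n => AddCommGrpCat.ofHom (barCobd G n)) n

theorem barComplex_obj_d_apply {n : ℕ} (c : BarCochain n G) :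
    (barComplex.obj G).d n (n + 1) c = barCobd G n c :=
  ConcreteCategory.congr_hom (barComplex_obj_d G n) c

instance : (barComplex (C := C)).PreservesZeroMorphisms where
  map_zero _ _ := rfl

theorem shortExact_map_barComplex {S : ShortComplex (Cᵒᵖ ⥤ AddCommGrpCat.{u})}
    (hS : S.ShortExact) : (S.map barComplex).ShortExact := by
  have hP (P : C) := hS.map_of_exact ((evaluation Cᵒᵖ AddCommGrpCat.{u}).obj (op P))
  refine HomologicalComplex.shortExact_of_degreewise_shortExact _ fun n =>
    ShortComplex.ShortExact.mk' ?_ ?_ ?_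
  · refine (ShortComplex.ab_exact_iff _).mpr fun (c : BarCochain n S.X₂) hc => ?_
    choose b hb using fun P s => (ShortComplex.ab_exact_iff _).mp (hP P).exact (c P s)
      (congrFun (congrFun hc P) s)
    exact ⟨b, funext fun P => funext fun s => hb P s⟩
  · refine (AddCommGrpCat.mono_iff_injective _).mpr fun b b' h => ?_
    exact funext fun P => funext fun s => (hP P).ab_injective_f (congrFun (congrFun h P) s)
  · refine (AddCommGrpCat.epi_iff_surjective _).mpr fun (c : BarCochain n S.X₃) => ?_
    choose b hb using fun P s => (hP P).ab_surjective_g (c P s)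
    exact ⟨b, funext fun P => funext fun s => hb P s⟩

section Coinduced

/-- The functor coinduced from a family `A` of abelian groups, with value `∏_{Q → P} A(Q)` at
`P`. -/
def coinduced (A : C → AddCommGrpCat.{u}) : Cᵒᵖ ⥤ AddCommGrpCat.{u} where
  obj P := AddCommGrpCat.of (∀ Q : C, (Q ⟶ P.unop) → A Q)
  map f := AddCommGrpCat.ofHom
    (AddMonoidHom.mk' (fun x Q e => x Q (e ≫ f.unop)) fun _ _ => rfl)
  map_id P := by
    ext x Q e
    exact congrArg (x Q) (Category.comp_id e)
  map_comp f g := by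
    ext x Q e
    exact congrArg (x Q) (Category.assoc e g.unop f.unop).symm

/-- The embedding of a functor in a coinduced one. -/
def toCoinduced (G : Cᵒᵖ ⥤ AddCommGrpCat.{u}) : G ⟶ coinduced fun P => G.obj (op P) where
  app P := AddCommGrpCat.ofHom
    (AddMonoidHom.mk' (fun x Q e => G.map e.op x) fun x y => by
      funext Q e
      exact map_add (G.map e.op).hom x y)
  naturality _ _ f := by
    ext x
    funext Q e
    exact (by simp : G.map e.op (G.map f x) = G.map (e ≫ f.unop).op x)

instance (G : Cᵒᵖ ⥤ AddCommGrpCat.{u}) : Mono (toCoinduced G) := by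
  have (P : Cᵒᵖ) : Mono ((toCoinduced G).app P) := by
    refine (AddCommGrpCat.mono_iff_injective _).mpr fun x y h => ?_
    have hid : G.map (𝟙 P.unop).op x = G.map (𝟙 P.unop).op y :=
      congrFun (congrFun h P.unop) (𝟙 _)
    simpa using hid
  exact NatTrans.mono_of_mono_app _

variable {A : C → AddCommGrpCat.{u}}

/-- The contracting homotopy of the bar complex of a coinduced functor. -/
def coinducedHomotopy (n : ℕ) (c : BarCochain (n + 1) (coinduced A)) : BarCochain n (coinduced A) :=
  fun _ s Q e => c Q (cons e s) Q (𝟙 Q)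

theorem barCobd_coinducedHomotopy_add {n : ℕ} (c : BarCochain (n + 1) (coinduced A)) :
    barCobd _ n (coinducedHomotopy n c) + coinducedHomotopy (n + 1) (barCobd _ (n + 1) c) = c := by
  funext P s Q e
  obtain _ | @⟨_, _, R, f, s⟩ := s
  let ev {P' : C} (e' : Q ⟶ P') : (coinduced A).obj (op P') →+ A Q :=
    AddMonoidHom.mk' (fun x => x Q e') fun _ _ => rfl
  have hleft : innerCobd (fun t => c Q (cons e t) Q (𝟙 Q)) (cons f s) =
      innerCobd (coinducedHomotopy n c P) (cons f s) Q e :=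
    innerCobd_comp (ev e) (coinducedHomotopy n c P) (cons f s)
  have hright : innerCobd (fun t => c Q (cons e t) Q (𝟙 Q)) (cons f s) =
      innerCobd (fun t => c Q (cons e t)) (cons f s) Q (𝟙 Q) :=
    innerCobd_comp (ev (𝟙 Q)) (fun t => c Q (cons e t)) (cons f s)
  change (c Q (cons (e ≫ f) s) Q (𝟙 Q) - innerCobd (coinducedHomotopy n c P) (cons f s) Q e) +
    (c P (cons f s) Q (𝟙 Q ≫ e) - (c Q (cons (e ≫ f) s) Q (𝟙 Q) -
      innerCobd (fun t => c Q (cons e t)) (cons f s) Q (𝟙 Q))) = c P (cons f s) Q e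
  rw [← hleft, hright, Category.id_comp]
  abel

theorem exists_barCobd_eq_of_injective [Injective G] {n : ℕ} {c : BarCochain (n + 1) G}
    (hc : barCobd G (n + 1) c = 0) : ∃ b, barCobd G n b = c := by
  let i := toCoinduced G
  let r := Injective.factorThru (𝟙 G) i
  have hri (b : BarCochain (n + 1) G) : mapBarCochain r (n + 1) (mapBarCochain i (n + 1) b) = b :=
    funext fun P => funext fun s => by
      have hr : i ≫ r = 𝟙 G := Injective.comp_factorThru _ _
      exact congrArg (fun α : G ⟶ G => α.app (op P) (b P s)) hr
  refine ⟨mapBarCochain r n (coinducedHomotopy n (mapBarCochain i (n + 1) c)), ?_⟩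
  have h := barCobd_coinducedHomotopy_add (mapBarCochain i (n + 1) c)
  rw [barCobd_mapBarCochain, hc, map_zero] at h
  rw [barCobd_mapBarCochain, (add_zero _).symm.trans h, hri]

theorem isEffaceableComplex_barComplex : IsEffaceableComplex (barComplex (C := C)) where
  shortExact_map := shortExact_map_barComplex
  isZero_homology G _ n := by
    rw [← HomologicalComplex.exactAt_iff_isZero_homology,
      HomologicalComplex.exactAt_iff' _ n (n + 1) (n + 2) (by simp) (by simp),
      ShortComplex.ab_exact_iff]
    intro c hc
    change (barComplex.obj G).d (n + 1) (n + 2) c = 0 at hc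
    change ∃ b, (barComplex.obj G).d n (n + 1) b = c
    rw [barComplex_obj_d] at hc ⊢
    exact exists_barCobd_eq_of_injective hc

end Coinduced

section Limit

/-- The projections of a limit, as a `0`-cochain of the bar complex. -/
noncomputable def limitToBarCochain (G : Cᵒᵖ ⥤ AddCommGrpCat.{u}) :
    Limits.limit G ⟶ (barComplex.obj G).X 0 :=
  AddCommGrpCat.ofHom (AddMonoidHom.mk' (fun x P _ => Limits.limit.π G (op P) x) fun x y =>
    funext fun P => funext fun _ => map_add (Limits.limit.π G (op P)).hom x y)

theorem barCobd_zero_apply (c : BarCochain 0 G) {P Q : C} (f : P ⟶ Q) :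
    barCobd G 0 c P (cons f (nil Q)) = G.map f.op (c Q (nil Q)) - c P (nil P) :=
  rfl

theorem limitToBarCochain_comp_d (G : Cᵒᵖ ⥤ AddCommGrpCat.{u}) :
    limitToBarCochain G ≫ (barComplex.obj G).d 0 1 = 0 := by
  rw [barComplex_obj_d]
  ext x
  funext P s
  obtain _ | ⟨f, _ | _⟩ := s
  refine (barCobd_zero_apply _ f).trans (sub_eq_zero.mpr ?_)
  exact ConcreteCategory.congr_hom (Limits.limit.w G f.op) x

/-- The cone defined by a family of `0`-cocycles of the bar complex. -/
def coneOfCocycle {A : AddCommGrpCat.{u}} (x : A ⟶ (barComplex.obj G).X 0)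
    (hx : x ≫ (barComplex.obj G).d 0 1 = 0) : Limits.Cone G where
  pt := A
  π :=
    { app P := x ≫ AddCommGrpCat.ofHom
        (AddMonoidHom.mk' (fun c : BarCochain 0 G => c P.unop (nil _)) fun _ _ => rfl)
      naturality P Q f := by
        ext a
        have h := congrFun (congrFun (ConcreteCategory.congr_hom hx a) Q.unop)
          (cons f.unop (nil _))
        rw [barComplex_obj_d] at h
        exact (sub_eq_zero.mp h).symm }

/-- A limit is the group of `0`-cocycles of the bar complex. -/
noncomputable def limitToBarCochainIsKernel (G : Cᵒᵖ ⥤ AddCommGrpCat.{u}) :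
    Limits.IsLimit (Limits.KernelFork.ofι _ (limitToBarCochain_comp_d G)) :=
  Limits.KernelFork.IsLimit.ofι _ _
    (fun x hx => Limits.limit.lift G (coneOfCocycle x hx))
    (fun x hx => by
      ext a
      funext P s
      obtain _ | _ := s
      exact ConcreteCategory.congr_hom (Limits.limit.lift_π (coneOfCocycle x hx) (op P)) a)
    (fun x hx m hm => Limits.limit.hom_ext fun P => by
      subst hm
      exact (Limits.limit.lift_π (coneOfCocycle _ hx) P).symm)

theorem limitToBarCochain_naturality {G' : Cᵒᵖ ⥤ AddCommGrpCat.{u}} (α : G ⟶ G') :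
    Limits.limMap α ≫ limitToBarCochain G' =
      limitToBarCochain G ≫ (barComplex.map α).f 0 := by
  ext x
  funext P _
  exact ConcreteCategory.congr_hom (Limits.limMap_π α (op P)) x

/-- A limit is isomorphic to the cycles of the bar complex in degree `0`. -/
noncomputable def limitIsoCycles (G : Cᵒᵖ ⥤ AddCommGrpCat.{u}) :
    Limits.limit G ≅ (barComplex.obj G).cycles 0 :=
  (limitToBarCochainIsKernel G).conePointUniqueUpToIso
    ((barComplex.obj G).cyclesIsKernel 0 1 (by simp))

theorem limitIsoCycles_naturality {G' : Cᵒᵖ ⥤ AddCommGrpCat.{u}} (α : G ⟶ G') :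
    Limits.limMap α ≫ (limitIsoCycles G').hom =
      (limitIsoCycles G).hom ≫ HomologicalComplex.cyclesMap (barComplex.map α) 0 := by
  have hi (G : Cᵒᵖ ⥤ AddCommGrpCat.{u}) :
      (limitIsoCycles G).hom ≫ (barComplex.obj G).iCycles 0 = limitToBarCochain G :=
    Limits.IsLimit.conePointUniqueUpToIso_hom_comp _ _ Limits.WalkingParallelPair.zero
  rw [← cancel_mono ((barComplex.obj G').iCycles 0), Category.assoc, hi, Category.assoc,
    HomologicalComplex.cyclesMap_i, ← Category.assoc, hi]
  exact limitToBarCochain_naturality α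

/-- The inverse limit is the cohomology in degree `0` of the bar complex. -/
noncomputable def limIsoHomologyZero :
    (Limits.lim : (Cᵒᵖ ⥤ AddCommGrpCat.{u}) ⥤ _) ≅
      barComplex ⋙ HomologicalComplex.homologyFunctor AddCommGrpCat.{u} _ 0 :=
  NatIso.ofComponents (fun G => limitIsoCycles G ≪≫ (barComplex.obj G).isoHomologyπ₀)
    (fun {G G'} α => by
      change Limits.limMap α ≫ (limitIsoCycles G').hom ≫ (barComplex.obj G').homologyπ 0 =
        ((limitIsoCycles G).hom ≫ (barComplex.obj G).homologyπ 0) ≫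
          HomologicalComplex.homologyMap (barComplex.map α) 0
      rw [reassoc_of% limitIsoCycles_naturality α, Category.assoc,
        HomologicalComplex.homologyπ_naturality])

end Limit

theorem nonempty_higherLim_iso_homology_barComplex (G : Cᵒᵖ ⥤ AddCommGrpCat.{u}) (n : ℕ) :
    Nonempty (higherLim (n + 1) G ≅ (barComplex.obj G).homology (n + 1)) :=
  isEffaceableComplex_barComplex.nonempty_rightDerived_iso limIsoHomologyZero G n

section Comparison

/-- Cocycles modulo coboundaries, in a sequence `A ⟶ B ⟶ D` identified with three
consecutive terms of a cochain complex. -/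
noncomputable def homologyEquivKerModRange {K : CochainComplex AddCommGrpCat.{u} ℕ} {n : ℕ}
    {A B D : Type u} [AddCommGroup A] [AddCommGroup B] [AddCommGroup D] {f : A →+ B} {g : B →+ D}
    (eA : K.X n ≃+ A) (eB : K.X (n + 1) ≃+ B) (eD : K.X (n + 2) ≃+ D)
    (hf : ∀ x, f (eA x) = eB (K.d n (n + 1) x))
    (hg : ∀ x, g (eB x) = eD (K.d (n + 1) (n + 2) x)) :
    K.homology (n + 1) ≃+ g.ker ⧸ f.range.addSubgroupOf g.ker := by
  have hfg : AddCommGrpCat.ofHom f ≫ AddCommGrpCat.ofHom g = 0 := by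
    ext a
    obtain ⟨x, rfl⟩ := eA.surjective a
    have hd := ConcreteCategory.congr_hom (K.d_comp_d n (n + 1) (n + 2)) x
    exact (congrArg g (hf x)).trans ((hg _).trans ((congrArg eD hd).trans (map_zero eD)))
  let T := ShortComplex.mk (AddCommGrpCat.ofHom f) (AddCommGrpCat.ofHom g) hfg
  have hrange : T.abToCycles.range = f.range.addSubgroupOf g.ker := by
    ext b
    exact ⟨fun ⟨a, ha⟩ => ⟨a, congrArg Subtype.val ha⟩, fun ⟨a, ha⟩ => ⟨a, Subtype.ext ha⟩⟩
  let e : K.sc' n (n + 1) (n + 2) ≅ T :=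
    ShortComplex.isoMk eA.toAddCommGrpIso eB.toAddCommGrpIso eD.toAddCommGrpIso
      (by ext x; exact hf x) (by ext x; exact hg x)
  exact (ShortComplex.homologyMapIso (K.isoSc' n (n + 1) (n + 2) (by simp) (by simp) ≪≫ e) ≪≫
    T.abHomologyIso).addCommGroupIsoToAddEquiv.trans (QuotientAddGroup.quotientAddEquivOfEq hrange)

variable (G)

/-- Bar cochains of degree `1`, as functions of `1` composable morphisms. -/
def curryCochain₁ : BarCochain 1 G ≃+ Cochain₁ G where
  toFun c P Q f := c P (cons f (nil Q))
  invFun c P s := match s with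
    | cons f (nil _) => c P _ f
  left_inv c := by
    funext P s
    obtain _ | ⟨f, _ | _⟩ := s
    rfl
  right_inv _ := rfl
  map_add' _ _ := rfl

/-- Bar cochains of degree `2`, as functions of `2` composable morphisms. -/
def curryCochain₂ : BarCochain 2 G ≃+ Cochain₂ G where
  toFun c P Q R f g := c P (cons f (cons g (nil R)))
  invFun c P s := match s with
    | cons f (cons g (nil _)) => c P _ _ f g
  left_inv c := by
    funext P s
    obtain _ | ⟨f, _ | ⟨g, _ | _⟩⟩ := s
    rfl
  right_inv _ := rfl
  map_add' _ _ := rfl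

/-- Bar cochains of degree `3`, as functions of `3` composable morphisms. -/
def curryCochain₃ : BarCochain 3 G ≃+ Cochain₃ G where
  toFun c P Q R T f g h := c P (cons f (cons g (cons h (nil T))))
  invFun c P s := match s with
    | cons f (cons g (cons h (nil _))) => c P _ _ _ f g h
  left_inv c := by
    funext P s
    obtain _ | ⟨f, _ | ⟨g, _ | ⟨h, _ | _⟩⟩⟩ := s
    rfl
  right_inv _ := rfl
  map_add' _ _ := rfl

/-- Bar cochains of degree `4`, as functions of `4` composable morphisms. -/
def curryCochain₄ : BarCochain 4 G ≃+ Cochain₄ G where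
  toFun c P Q R T U f g h k := c P (cons f (cons g (cons h (cons k (nil U)))))
  invFun c P s := match s with
    | cons f (cons g (cons h (cons k (nil _)))) => c P _ _ _ _ f g h k
  left_inv c := by
    funext P s
    obtain _ | ⟨f, _ | ⟨g, _ | ⟨h, _ | ⟨k, _ | _⟩⟩⟩⟩ := s
    rfl
  right_inv _ := rfl
  map_add' _ _ := rfl

variable {G}

theorem d₁_curryCochain₁ (c : BarCochain 1 G) :
    d₁ G (curryCochain₁ G c) = curryCochain₂ G (barCobd G 1 c) := by
  have h {A : Type u} [AddCommGroup A] (a b c : A) : a - b + c = a - (b - c) := by abel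
  funext P Q R f g
  exact h _ _ _

theorem d₂_curryCochain₂ (c : BarCochain 2 G) :
    d₂ G (curryCochain₂ G c) = curryCochain₃ G (barCobd G 2 c) := by
  have h {A : Type u} [AddCommGroup A] (a b c d : A) : a - b + c - d = a - (b - (c - d)) := by abel
  funext P Q R T f g h'
  exact h _ _ _ _

theorem d₃_curryCochain₃ (c : BarCochain 3 G) :
    d₃ G (curryCochain₃ G c) = curryCochain₄ G (barCobd G 3 c) := by
  have h {A : Type u} [AddCommGroup A] (a b c d e : A) :
      a - b + c - d + e = a - (b - (c - (d - e))) := by abel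
  funext P Q R T U f g h' k
  exact h _ _ _ _ _

theorem nonempty_barH₂_addEquiv_higherLim (G : Cᵒᵖ ⥤ AddCommGrpCat.{u}) :
    Nonempty (BarH₂ G ≃+ higherLim 2 G) := by
  obtain ⟨e⟩ := nonempty_higherLim_iso_homology_barComplex G 1
  exact ⟨(e.addCommGroupIsoToAddEquiv.trans (homologyEquivKerModRange (curryCochain₁ G)
    (curryCochain₂ G) (curryCochain₃ G)
    (fun c => (d₁_curryCochain₁ c).trans (congrArg _ (barComplex_obj_d_apply c).symm))
    fun c => (d₂_curryCochain₂ c).trans (congrArg _ (barComplex_obj_d_apply c).symm))).symm⟩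

theorem nonempty_barH₃_addEquiv_higherLim (G : Cᵒᵖ ⥤ AddCommGrpCat.{u}) :
    Nonempty (BarH₃ G ≃+ higherLim 3 G) := by
  obtain ⟨e⟩ := nonempty_higherLim_iso_homology_barComplex G 2
  exact ⟨(e.addCommGroupIsoToAddEquiv.trans (homologyEquivKerModRange (curryCochain₂ G)
    (curryCochain₃ G) (curryCochain₄ G)
    (fun c => (d₂_curryCochain₂ c).trans (congrArg _ (barComplex_obj_d_apply c).symm))
    fun c => (d₃_curryCochain₃ c).trans (congrArg _ (barComplex_obj_d_apply c).symm))).symm⟩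

end Comparison

end BarComplex

end HigherLimits

namespace FusionSystem

variable {S : Type u} [Group S] {F : FusionSystem S} {X : Set (Subgroup S)}

/-! ### The functor `Z_F^X` and its cochains -/

theorem exists_mem_center_of_comm {P Q : Subgroup S} (hP : P ∈ F.centric) (φ : F.Hom P Q) {q : Q}
    (hq : ∀ x, q * φ.1 x = φ.1 x * q) : ∃ z ∈ Subgroup.center P, φ.1 z = q := by
  obtain ⟨φ, hφ⟩ := φ
  obtain ⟨R, hR, e, he, he', rfl⟩ := F.exists_factor hφ
  have hqR : (q : S) ∈ R := by
    refine hP R ⟨e, he, he'⟩ (Subgroup.mem_centralizer_iff.mpr fun x hx => ?_)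
    simpa using (congrArg Subtype.val (hq (e.symm ⟨x, hx⟩))).symm
  have hz : ((Subgroup.inclusion hR).comp e.toMonoidHom) (e.symm ⟨q, hqR⟩) = q := by
    ext
    simp
  refine ⟨e.symm ⟨q, hqR⟩, Subgroup.mem_center_iff.mpr fun x => F.injective hφ ?_, hz⟩
  rw [map_mul, map_mul, hz]
  exact (hq x).symm

theorem exists_mem_center_of_conj_eq {P Q : Subgroup S} (hP : P ∈ F.centric) (φ : F.Hom P Q)
    {a b : Q} {ψ : P → Q} (ha : ∀ x, ψ x * a = a * φ.1 x) (hb : ∀ x, ψ x * b = b * φ.1 x) :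
    ∃ z ∈ Subgroup.center P, a = b * φ.1 z := by
  obtain ⟨z, hz, h⟩ := exists_mem_center_of_comm hP φ (q := b⁻¹ * a) fun x => by
    have hb' : b⁻¹ * ψ x = φ.1 x * b⁻¹ := by
      rw [eq_mul_inv_iff_mul_eq, mul_assoc, hb, inv_mul_cancel_left]
    rw [mul_assoc, ← ha, ← mul_assoc, hb', mul_assoc]
  exact ⟨z, hz, by rw [h, mul_inv_cancel_left]⟩

section OrbitCategory

variable {Y : Set (Subgroup S)} {P Q R : F.OrbitCategory Y}

theorem orbitClass_homComp (φ : F.Hom P.obj Q.obj) (ψ : F.Hom Q.obj R.obj) :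
    (F.orbitClass (F.homComp φ ψ) : P ⟶ R) =
      (F.orbitClass φ : P ⟶ Q) ≫ (F.orbitClass ψ : Q ⟶ R) := rfl

theorem orbitClass_eq_iff {φ ψ : F.Hom P.obj Q.obj} :
    (F.orbitClass φ : P ⟶ Q) = F.orbitClass ψ ↔ ∃ q : Q.obj, ∀ x, ψ.1 x = q * φ.1 x * q⁻¹ :=
  ⟨fun h => Quotient.exact h, fun h => Quotient.sound h⟩

theorem mem_of_orbitHom (hX : F.IsClosedFamily X) (f : P ⟶ Q) (hP : P.obj ∈ X) : Q.obj ∈ X :=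
  mem_of_hom hX (Quotient.out f) hP

end OrbitCategory

section CenterFunctor

variable {hX : F.IsClosedFamily X} {P Q : F.OrbitCategory F.centric}

theorem centerVal_mem_center (x : (centerFunctor hX).obj (op P)) :
    centerVal x ∈ Subgroup.center P.obj :=
  (Additive.toMul (α := centerOn X P.obj) x).2.1

theorem centerVal_add (x y : (centerFunctor hX).obj (op P)) :
    centerVal (x + y) = centerVal x * centerVal y := rfl

theorem centerVal_zero : centerVal (0 : (centerFunctor hX).obj (op P)) = 1 := rfl

theorem centerVal_ext {x y : (centerFunctor hX).obj (op P)}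
    (h : P.obj ∈ X → centerVal x = centerVal y) : x = y :=
  centerOn_ext (P := P.obj) (w := Additive.toMul (α := centerOn X P.obj) x)
    (w' := Additive.toMul (α := centerOn X P.obj) y) h

theorem exists_centerVal_eq (hP : P.obj ∈ X) {z : P.obj} (hz : z ∈ Subgroup.center P.obj) :
    ∃ x : (centerFunctor hX).obj (op P), centerVal x = z :=
  ⟨Additive.ofMul (⟨z, hz, fun h => absurd hP h⟩ : centerOn X P.obj), rfl⟩

theorem apply_centerVal_map (hP : P.obj ∈ X) {f : P ⟶ Q} {φ : F.Hom P.obj Q.obj}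
    (h : F.orbitClass φ = f) (x : (centerFunctor hX).obj (op Q)) :
    φ.1 (centerVal ((centerFunctor hX).map f.op x)) = centerVal x := by
  subst h
  exact centerOnMap_spec hX φ (Additive.toMul (α := centerOn X Q.obj) x) hP

theorem cochain₂_ext {c c' : Cochain₂ (centerFunctor hX)}
    (h : ∀ (P Q R : X) (f : hX.toOrbit P ⟶ hX.toOrbit Q) (g : hX.toOrbit Q ⟶ hX.toOrbit R),
      c _ _ _ f g = c' _ _ _ f g) : c = c' := by
  funext P Q R f g
  by_cases hP : P.obj ∈ X
  · have hQ := mem_of_orbitHom hX f hP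
    exact h ⟨P.obj, hP⟩ ⟨Q.obj, hQ⟩ ⟨R.obj, mem_of_orbitHom hX g hQ⟩ f g
  · exact centerVal_ext fun h => absurd h hP

theorem cochain₃_ext {c c' : Cochain₃ (centerFunctor hX)}
    (h : ∀ (P Q R T : X) (f : hX.toOrbit P ⟶ hX.toOrbit Q) (g : hX.toOrbit Q ⟶ hX.toOrbit R)
      (k : hX.toOrbit R ⟶ hX.toOrbit T), c _ _ _ _ f g k = c' _ _ _ _ f g k) : c = c' := by
  funext P Q R T f g k
  by_cases hP : P.obj ∈ X
  · have hQ := mem_of_orbitHom hX f hP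
    have hR := mem_of_orbitHom hX g hQ
    exact h ⟨P.obj, hP⟩ ⟨Q.obj, hQ⟩ ⟨R.obj, hR⟩ ⟨T.obj, mem_of_orbitHom hX k hR⟩ f g k
  · exact centerVal_ext fun h => absurd h hP

/-- The group `Z_F^X(P)` for `P ∈ X`. -/
noncomputable abbrev CenterAt (hX : F.IsClosedFamily X) (P : X) : AddCommGrpCat.{u} :=
  (centerFunctor hX).obj (op (hX.toOrbit P))

/-- The element of `P` underlying an element of `Z_F^X(P)`, for `P ∈ X`: this is `centerVal`, typed
in `P` itself rather than in the object of the orbit category defined by `P`. -/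
def centerAtVal {P : X} (x : CenterAt hX P) : P.1 := centerVal x

theorem centerAtVal_mem_center {P : X} (x : CenterAt hX P) :
    centerAtVal x ∈ Subgroup.center P.1 :=
  centerVal_mem_center x

theorem mul_centerAtVal_comm {P : X} (x : CenterAt hX P) (a : P.1) :
    a * centerAtVal x = centerAtVal x * a :=
  Subgroup.mem_center_iff.mp (centerAtVal_mem_center x) a

theorem centerAtVal_injective {P : X} : Function.Injective (centerAtVal (hX := hX) (P := P)) :=
  fun _ _ h => centerVal_ext fun _ => h

variable (hX)

theorem exists_centerAtVal_eq {P : X} {z : P.1} (hz : z ∈ Subgroup.center P.1) :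
    ∃ x : CenterAt hX P, centerAtVal x = z :=
  exists_centerVal_eq (P := hX.toOrbit P) P.2 hz

open Classical in
/-- Extension by zero to all `F`-centric subgroups of a `1`-cochain defined on `X`. -/
noncomputable def extend₁ (c : ∀ P Q : X, (hX.toOrbit P ⟶ hX.toOrbit Q) → CenterAt hX P) :
    Cochain₁ (centerFunctor hX) := fun P Q f =>
  if h : P.obj ∈ X ∧ Q.obj ∈ X then c ⟨P.obj, h.1⟩ ⟨Q.obj, h.2⟩ f else 0

open Classical in
/-- Extension by zero to all `F`-centric subgroups of a `2`-cochain defined on `X`. -/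
noncomputable def extend₂ (c : ∀ P Q R : X, (hX.toOrbit P ⟶ hX.toOrbit Q) →
    (hX.toOrbit Q ⟶ hX.toOrbit R) → CenterAt hX P) :
    Cochain₂ (centerFunctor hX) := fun P Q R f g =>
  if h : P.obj ∈ X ∧ Q.obj ∈ X ∧ R.obj ∈ X then
    c ⟨P.obj, h.1⟩ ⟨Q.obj, h.2.1⟩ ⟨R.obj, h.2.2⟩ f g else 0

theorem extend₁_apply (c : ∀ P Q : X, (hX.toOrbit P ⟶ hX.toOrbit Q) → CenterAt hX P) (P Q : X)
    (f : hX.toOrbit P ⟶ hX.toOrbit Q) :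
    extend₁ hX c (hX.toOrbit P) (hX.toOrbit Q) f = c P Q f :=
  dif_pos ⟨P.2, Q.2⟩

theorem extend₂_apply (c : ∀ P Q R : X, (hX.toOrbit P ⟶ hX.toOrbit Q) →
    (hX.toOrbit Q ⟶ hX.toOrbit R) → CenterAt hX P) (P Q R : X)
    (f : hX.toOrbit P ⟶ hX.toOrbit Q) (g : hX.toOrbit Q ⟶ hX.toOrbit R) :
    extend₂ hX c (hX.toOrbit P) (hX.toOrbit Q) (hX.toOrbit R) f g = c P Q R f g :=
  dif_pos ⟨P.2, Q.2, R.2⟩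

end CenterFunctor

namespace LinkingSystem

variable (L : F.LinkingSystem X)

theorem δSelf_one (P : X) : L.δSelf P 1 = L.id P := L.δ_one P

theorem δSelf_mul (P : X) (a b : P.1) :
    L.δSelf P (a * b) = L.comp (L.δSelf P b) (L.δSelf P a) :=
  L.δ_mul (P := P) ⟨b.1, mem_transporter_self b.2⟩ ⟨a.1, mem_transporter_self a.2⟩

theorem π_δSelf_apply (P : X) (a x : P.1) : (L.π (L.δSelf P a)).1 x = a * x * a⁻¹ := by
  rw [δSelf, π_δ]
  rfl

theorem π_comp_apply {P Q R : X} (f : L.Mor P Q) (g : L.Mor Q R) (x : P.1) :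
    (L.π (L.comp f g)).1 x = (L.π g).1 ((L.π f).1 x) := by
  rw [π_comp]
  rfl

theorem δSelf_comp {P Q : X} (f : L.Mor P Q) (a : P.1) :
    L.comp (L.δSelf P a) f = L.comp f (L.δSelf Q ((L.π f).1 a)) :=
  L.δ_comp f a

theorem comp_right_cancel {P Q R : X} {f f' : L.Mor P Q} {g : L.Mor Q R}
    (h : L.comp f g = L.comp f' g) : f = f' := by
  have hπ : L.π f = L.π f' := by
    apply Subtype.ext
    ext1 x
    apply F.injective (L.π g).2
    rw [← π_comp_apply, ← π_comp_apply, h]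
  obtain ⟨z, hz, rfl⟩ := (L.π_eq_iff f f').mp hπ
  rw [assoc] at h
  have := L.free (L.comp f g) z hz h.symm
  subst this
  exact ((congrArg (fun k => L.comp k f) (L.δSelf_one P)).trans (L.id_comp f)).symm

theorem comp_δSelf_injective (hX : F.IsClosedFamily X) {P Q : X} (f : L.Mor P Q) {a b : Q.1}
    (h : L.comp f (L.δSelf Q a) = L.comp f (L.δSelf Q b)) : a = b := by
  have h1 : L.comp f (L.δSelf Q (b⁻¹ * a)) = f := by
    rw [δSelf_mul, ← assoc, h, assoc, ← δSelf_mul, inv_mul_cancel, δSelf_one, comp_id]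
  obtain ⟨z, hz, hz'⟩ := exists_mem_center_of_comm (hX.centric P.2) (L.π f) (q := b⁻¹ * a)
    fun x => by
      have h2 : (L.π (L.comp f (L.δSelf Q (b⁻¹ * a)))).1 x = (L.π f).1 x := by rw [h1]
      rwa [π_comp_apply, π_δSelf_apply, mul_inv_eq_iff_eq_mul] at h2
  rw [← hz', ← δSelf_comp] at h1
  rw [L.free f z hz h1, map_one] at hz'
  exact (inv_mul_eq_one.mp hz'.symm).symm

variable (hX : F.IsClosedFamily X)

/-- The automorphism of `P` given by an element of `Z(P)`. -/
def δCenter (P : X) (x : CenterAt hX P) : L.Mor P P := L.δSelf P (centerAtVal x)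

theorem δCenter_zero (P : X) : L.δCenter hX P 0 = L.id P := L.δSelf_one P

theorem δCenter_add (P : X) (x y : CenterAt hX P) :
    L.comp (L.δCenter hX P x) (L.δCenter hX P y) = L.δCenter hX P (x + y) := by
  rw [add_comm]
  exact (L.δSelf_mul P _ _).symm

theorem δCenter_add_assoc {P Q : X} (x y : CenterAt hX P) (f : L.Mor P Q) :
    L.comp (L.δCenter hX P x) (L.comp (L.δCenter hX P y) f) =
      L.comp (L.δCenter hX P (x + y)) f := by
  rw [← assoc, δCenter_add]

theorem comp_δCenter {P Q : X} (f : L.Mor P Q) (x : CenterAt hX Q) :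
    L.comp f (L.δCenter hX Q x) =
      L.comp (L.δCenter hX P ((centerFunctor hX).map (L.orbitMor hX f).op x)) f := by
  rw [δCenter, δCenter, δSelf_comp]
  congr 2
  exact (apply_centerVal_map (P := hX.toOrbit P) P.2 rfl x).symm

theorem comp_δCenter_assoc {P Q R : X} (f : L.Mor P Q) (x : CenterAt hX Q) (g : L.Mor Q R) :
    L.comp f (L.comp (L.δCenter hX Q x) g) =
      L.comp (L.δCenter hX P ((centerFunctor hX).map (L.orbitMor hX f).op x)) (L.comp f g) := by
  rw [← assoc, comp_δCenter, assoc]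

theorem δCenter_comp_comp {P Q R : X} (x : CenterAt hX P) (f : L.Mor P Q) (y : CenterAt hX Q)
    (g : L.Mor Q R) :
    L.comp (L.comp (L.δCenter hX P x) f) (L.comp (L.δCenter hX Q y) g) =
      L.comp (L.δCenter hX P (x + (centerFunctor hX).map (L.orbitMor hX f).op y))
        (L.comp f g) := by
  rw [assoc, comp_δCenter_assoc, δCenter_add_assoc]

theorem π_δCenter_comp {P Q : X} (x : CenterAt hX P) (f : L.Mor P Q) :
    L.π (L.comp (L.δCenter hX P x) f) = L.π f :=
  ((L.π_eq_iff f _).mpr ⟨centerAtVal x, centerAtVal_mem_center x, rfl⟩).symm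

theorem exists_δCenter_comp {P Q : X} {f f' : L.Mor P Q} (h : L.π f = L.π f') :
    ∃ x : CenterAt hX P, f' = L.comp (L.δCenter hX P x) f := by
  obtain ⟨z, hz, rfl⟩ := (L.π_eq_iff f f').mp h
  obtain ⟨x, hx⟩ := exists_centerAtVal_eq hX hz
  refine ⟨x, ?_⟩
  rw [δCenter, hx]
  rfl

theorem δCenter_comp_injective {P Q : X} {x y : CenterAt hX P} {f : L.Mor P Q}
    (h : L.comp (L.δCenter hX P x) f = L.comp (L.δCenter hX P y) f) : x = y := by
  have h1 := L.comp_right_cancel h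
  have h2 : L.comp (L.id P) (L.δSelf P (centerAtVal x)) =
      L.comp (L.id P) (L.δSelf P (centerAtVal y)) := by
    rw [id_comp, id_comp]
    exact h1
  exact centerAtVal_injective (L.comp_δSelf_injective hX (L.id P) h2)

theorem δSelf_comp_δCenter {P Q : X} (a : P.1) (x : CenterAt hX P) (f : L.Mor P Q) :
    L.comp (L.δSelf P a) (L.comp (L.δCenter hX P x) f) =
      L.comp (L.δCenter hX P x) (L.comp (L.δSelf P a) f) := by
  rw [← assoc, ← assoc, δCenter, ← δSelf_mul, ← δSelf_mul]
  congr 2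
  exact (mul_centerAtVal_comm x a).symm

theorem orbitMor_comp {P Q R : X} (f : L.Mor P Q) (g : L.Mor Q R) :
    L.orbitMor hX (L.comp f g) = L.orbitMor hX f ≫ L.orbitMor hX g := by
  rw [orbitMor, π_comp]
  rfl

theorem orbitMor_id (P : X) : L.orbitMor hX (L.id P) = 𝟙 _ := by
  rw [orbitMor, π_id]
  rfl

theorem orbitMor_eq_iff {P Q : X} {f f' : L.Mor P Q} :
    L.orbitMor hX f = L.orbitMor hX f' ↔ ∃ q : Q.1, ∀ x, (L.π f').1 x = q * (L.π f).1 x * q⁻¹ :=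
  orbitClass_eq_iff

theorem orbitMor_comp_δSelf {P Q : X} (f : L.Mor P Q) (q : Q.1) :
    L.orbitMor hX (L.comp f (L.δSelf Q q)) = L.orbitMor hX f := by
  refine ((L.orbitMor_eq_iff hX).mpr ⟨q, fun x => ?_⟩).symm
  rw [π_comp_apply, π_δSelf_apply]

theorem orbitMor_δSelf_comp {P Q : X} (a : P.1) (f : L.Mor P Q) :
    L.orbitMor hX (L.comp (L.δSelf P a) f) = L.orbitMor hX f := by
  rw [δSelf_comp, orbitMor_comp_δSelf]

theorem orbitMor_δSelf (P : X) (a : P.1) : L.orbitMor hX (L.δSelf P a) = 𝟙 _ := by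
  rw [← L.comp_id (L.δSelf P a), orbitMor_δSelf_comp, orbitMor_id]

theorem orbitMor_surjective {P Q : X} (m : hX.toOrbit P ⟶ hX.toOrbit Q) :
    ∃ f : L.Mor P Q, L.orbitMor hX f = m := by
  obtain ⟨φ, rfl⟩ := Quotient.exists_rep m
  obtain ⟨f, rfl⟩ := L.π_surjective φ
  exact ⟨f, rfl⟩

theorem exists_comp_δSelf {P Q : X} {f f' : L.Mor P Q}
    (h : L.orbitMor hX f = L.orbitMor hX f') : ∃ q, f' = L.comp f (L.δSelf Q q) := by
  obtain ⟨q, hq⟩ := (L.orbitMor_eq_iff hX).mp h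
  have hπ : L.π (L.comp f (L.δSelf Q q)) = L.π f' := by
    apply Subtype.ext
    ext1 x
    rw [π_comp_apply, π_δSelf_apply, hq]
  obtain ⟨z, -, rfl⟩ := (L.π_eq_iff _ _).mp hπ
  refine ⟨q * (L.π f).1 z, ?_⟩
  change L.comp (L.δSelf P z) (L.comp f (L.δSelf Q q)) = _
  rw [δSelf_mul, ← assoc, ← assoc, δSelf_comp]

theorem eq_of_orbitMor_eq {P Q : X} {A : Type*} {c : L.Mor P Q → A}
    (hc : ∀ f q, c (L.comp f (L.δSelf Q q)) = c f) {f f' : L.Mor P Q}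
    (h : L.orbitMor hX f = L.orbitMor hX f') : c f = c f' := by
  obtain ⟨q, rfl⟩ := L.exists_comp_δSelf hX h
  exact (hc f q).symm

end LinkingSystem

/-! ### Constructing linking systems -/

theorem homConj_apply {P Q : Subgroup S} (g : transporter P Q) (x : P) :
    ((F.homConj g).1 x : S) = g.1 * x * g.1⁻¹ := rfl

theorem IsClosedFamily.top_mem (hX : F.IsClosedFamily X) (hXne : X.Nonempty) : ⊤ ∈ X := by
  obtain ⟨P, hP⟩ := hXne
  exact hX.overgroup_mem P hP ⊤ le_top

/-- The data of a linking system in which the functor `δ` is only given on the groups `P ∈ X`. -/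
structure PreLinkingSystem (F : FusionSystem S) (X : Set (Subgroup S)) where
  Mor : X → X → Type u
  comp {P Q R : X} : Mor P Q → Mor Q R → Mor P R
  assoc {P Q R T : X} (f : Mor P Q) (g : Mor Q R) (h : Mor R T) :
    comp (comp f g) h = comp f (comp g h)
  π {P Q : X} : Mor P Q → F.Hom P.1 Q.1
  π_comp {P Q R : X} (f : Mor P Q) (g : Mor Q R) : π (comp f g) = F.homComp (π f) (π g)
  δ (P : X) : P.1 → Mor P P
  δ_mul (P : X) (a b : P.1) : δ P (a * b) = comp (δ P b) (δ P a)
  one_comp {P Q : X} (f : Mor P Q) : comp (δ P 1) f = f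
  comp_one {P Q : X} (f : Mor P Q) : comp f (δ Q 1) = f
  π_surjective {P Q : X} : Function.Surjective (π : Mor P Q → F.Hom P.1 Q.1)
  free {P Q : X} (f : Mor P Q) (z : P.1) (hz : z ∈ Subgroup.center P.1) :
    comp (δ P z) f = f → z = 1
  exists_of_π_eq {P Q : X} (f f' : Mor P Q) : π f = π f' →
    ∃ z : P.1, z ∈ Subgroup.center P.1 ∧ f' = comp (δ P z) f
  π_δ (P : X) (a x : P.1) : (π (δ P a)).1 x = a * x * a⁻¹
  δ_comp {P Q : X} (f : Mor P Q) (a : P.1) : comp (δ P a) f = comp f (δ Q ((π f).1 a))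

namespace PreLinkingSystem

variable (L : F.PreLinkingSystem X)

theorem π_comp_apply {P Q R : X} (f : L.Mor P Q) (g : L.Mor Q R) (x : P.1) :
    (L.π (L.comp f g)).1 x = (L.π g).1 ((L.π f).1 x) := by
  rw [π_comp]
  rfl

theorem comp_right_cancel {P Q R : X} {f f' : L.Mor P Q} {g : L.Mor Q R}
    (h : L.comp f g = L.comp f' g) : f = f' := by
  have hπ : L.π f = L.π f' := by
    apply Subtype.ext
    ext1 x
    apply F.injective (L.π g).2
    rw [← π_comp_apply, ← π_comp_apply, h]
  obtain ⟨z, hz, rfl⟩ := L.exists_of_π_eq f f' hπ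
  rw [assoc] at h
  rw [L.free (L.comp f g) z hz h.symm, one_comp]

theorem π_center_comp {P Q : X} (f : L.Mor P Q) {z : P.1} (hz : z ∈ Subgroup.center P.1) :
    L.π (L.comp (L.δ P z) f) = L.π f := by
  apply Subtype.ext
  ext1 x
  rw [π_comp_apply, π_δ, ← Subgroup.mem_center_iff.mp hz, mul_inv_cancel_right]

theorem π_δ_one (P : X) : L.π (L.δ P 1) = F.homId P.1 := by
  apply Subtype.ext
  ext1 x
  rw [π_δ]
  simp [homId]

theorem exists_lift {P Q R : X} (f : L.Mor P R) (g : L.Mor Q R) (φ : F.Hom P.1 Q.1)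
    (h : ∀ x, (L.π g).1 (φ.1 x) = (L.π f).1 x) : ∃ m, L.π m = φ ∧ L.comp m g = f := by
  obtain ⟨m, rfl⟩ := L.π_surjective φ
  obtain ⟨z, hz, rfl⟩ := L.exists_of_π_eq (L.comp m g) f (by
    apply Subtype.ext
    ext1 x
    rw [π_comp_apply, h])
  exact ⟨L.comp (L.δ P z) m, L.π_center_comp m hz, L.assoc _ _ _⟩

theorem exists_transporter_extension (hXne : X.Nonempty) (hX : F.IsClosedFamily X) :
    ∃ δ : ∀ {P Q : X}, transporter P.1 Q.1 → L.Mor P Q,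
      (∀ (P Q R : X) (g : transporter P.1 Q.1) (h : transporter Q.1 R.1),
        δ ⟨h.1 * g.1, mul_mem_transporter g.2 h.2⟩ = L.comp (δ g) (δ h)) ∧
      (∀ (P Q : X) (g : transporter P.1 Q.1), L.π (δ g) = F.homConj g) ∧
      (∀ (P : X) (a : P.1), δ ⟨a.1, mem_transporter_self a.2⟩ = L.δ P a) := by
  let T : X := ⟨⊤, hX.top_mem hXne⟩
  choose ι hι using fun P : X =>
    L.π_surjective (Q := T) (F.homConj ⟨1, fun _ _ => Subgroup.mem_top _⟩)
  have ι_apply (P : X) (x : P.1) : ((L.π (ι P)).1 x : S) = x := by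
    rw [hι, homConj_apply, one_mul, inv_one, mul_one]
  -- `δ g` is the lift of `c_g` which the chosen inclusions into `S` carry to the automorphism `g`.
  have lift (P Q : X) (g : transporter P.1 Q.1) : ∃ m : L.Mor P Q, L.π m = F.homConj g ∧
      L.comp m (ι Q) = L.comp (ι P) (L.δ T ⟨g.1, trivial⟩) := by
    refine L.exists_lift _ _ _ fun x => Subtype.ext ?_
    simp only [ι_apply, π_comp_apply, π_δ, homConj_apply, Subgroup.coe_mul, Subgroup.coe_inv]
  choose δ hδπ hδ using lift
  refine ⟨fun {P Q} => δ P Q, fun P Q R g h => ?_, hδπ, fun P a => ?_⟩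
  · apply L.comp_right_cancel (g := ι R)
    rw [hδ, L.assoc, hδ, ← L.assoc, hδ, L.assoc, ← L.δ_mul]
    rfl
  · apply L.comp_right_cancel (g := ι P)
    rw [hδ, L.δ_comp]
    congr 2
    exact Subtype.ext (ι_apply P a).symm

/-- The linking system determined by a prelinking system. -/
noncomputable def toLinkingSystem (hXne : X.Nonempty) (hX : F.IsClosedFamily X) :
    F.LinkingSystem X :=
  have h := (L.exists_transporter_extension hXne hX).choose_spec
  { Mor := L.Mor
    id := fun P => L.δ P 1
    comp := L.comp
    id_comp := L.one_comp
    comp_id := L.comp_one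
    assoc := L.assoc
    π := L.π
    π_id := L.π_δ_one
    π_comp := L.π_comp
    δ := (L.exists_transporter_extension hXne hX).choose
    δ_one := fun P => h.2.2 P 1
    δ_mul := h.1 _ _ _
    π_surjective := L.π_surjective
    free := fun f z hz hf => L.free f z hz (by rwa [h.2.2] at hf)
    π_eq_iff := fun {P Q} f f' => by
      refine ⟨fun hf => ?_, ?_⟩
      · obtain ⟨z, hz, rfl⟩ := L.exists_of_π_eq f f' hf
        exact ⟨z, hz, by rw [h.2.2]⟩
      · rintro ⟨z, hz, rfl⟩
        rw [h.2.2]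
        exact (L.π_center_comp f hz).symm
    π_δ := h.2.1 _ _
    δ_comp := fun f a => by
      rw [h.2.2, h.2.2]
      exact L.δ_comp f a }

theorem toLinkingSystem_δSelf (hXne : X.Nonempty) (hX : F.IsClosedFamily X) (P : X) (a : P.1) :
    (L.toLinkingSystem hXne hX).δSelf P a = L.δ P a :=
  (L.exists_transporter_extension hXne hX).choose_spec.2.2 P a

end PreLinkingSystem

/-! ### Twists -/

section Twist

variable {hX : F.IsClosedFamily X} {L L' L'' : F.LinkingSystem X}

/-- A map between the morphism sets from `P` to `Q` of two linking systems which commutes with the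
projections to `F` and with the action of `P`: the condition on the components of a twist. -/
structure IsEquivariant {P Q : X} (θ : L.Mor P Q → L'.Mor P Q) : Prop where
  π (f) : L'.π (θ f) = L.π f
  δSelf_comp (a : P.1) (f) : θ (L.comp (L.δSelf P a) f) = L'.comp (L'.δSelf P a) (θ f)

theorem IsEquivariant.δCenter_comp {P Q : X} {θ : L.Mor P Q → L'.Mor P Q}
    (h : IsEquivariant θ) (x : CenterAt hX P) (f : L.Mor P Q) :
    θ (L.comp (L.δCenter hX P x) f) = L'.comp (L'.δCenter hX P x) (θ f) :=
  h.δSelf_comp _ f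

include hX in
theorem IsEquivariant.bijective {P Q : X} {θ : L.Mor P Q → L'.Mor P Q} (h : IsEquivariant θ) :
    Function.Bijective θ := by
  constructor
  · intro f f' hf
    obtain ⟨x, rfl⟩ := L.exists_δCenter_comp hX
      (show L.π f = L.π f' by rw [← h.π, ← h.π, hf])
    rw [h.δCenter_comp] at hf
    have hx : (0 : CenterAt hX P) = x := L'.δCenter_comp_injective hX (f := θ f) (by
      rw [← hf, L'.δCenter_zero, L'.id_comp])
    rw [← hx, L.δCenter_zero, L.id_comp]
  · intro g
    obtain ⟨f, hf⟩ := L.π_surjective (L'.π g)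
    obtain ⟨x, rfl⟩ := L'.exists_δCenter_comp hX (show L'.π (θ f) = L'.π g by rw [h.π, hf])
    exact ⟨_, h.δCenter_comp x f⟩

theorem IsEquivariant.orbitMor {P Q : X} {θ : L.Mor P Q → L'.Mor P Q} (h : IsEquivariant θ)
    (f : L.Mor P Q) : L'.orbitMor hX (θ f) = L.orbitMor hX f :=
  congrArg (fun φ => F.orbitClass (P := hX.toOrbit P) (Q := hX.toOrbit Q) φ) (h.π f)

/-- Maps between the morphism sets of `L` and `L'` which exhibit `L'` as the twist of `L` by the
`2`-cochain `z`; see `IsTwist`. -/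
structure IsTwistMap (z : Cochain₂ (centerFunctor hX)) (θ : ∀ P Q : X, L.Mor P Q → L'.Mor P Q) :
    Prop where
  equivariant (P Q : X) : IsEquivariant (θ P Q)
  map_comp {P Q R : X} (f : L.Mor P Q) (g : L.Mor Q R) : θ P R (L.comp f g) =
    L'.comp (L'.δCenter hX P (z _ _ _ (L.orbitMor hX f) (L.orbitMor hX g)))
      (L'.comp (θ P Q f) (θ Q R g))

theorem isTwist_iff {z : Cochain₂ (centerFunctor hX)} : IsTwist hX z L L' ↔
    ∃ θ : ∀ P Q : X, L.Mor P Q → L'.Mor P Q, IsTwistMap z θ :=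
  ⟨fun ⟨θ, hπ, hδ, hcomp⟩ => ⟨θ, fun P Q => ⟨hπ P Q, hδ P Q⟩, hcomp _ _ _⟩,
    fun ⟨θ, h⟩ => ⟨θ, fun P Q => (h.equivariant P Q).π, fun P Q => (h.equivariant P Q).δSelf_comp,
      fun _ _ _ => h.map_comp⟩⟩

theorem LinkingSystem.Iso.isTwist_zero (hX : F.IsClosedFamily X) (h : L.Iso L') :
    IsTwist hX 0 L L' := by
  obtain ⟨Ψ, -, hcomp, hπ, hδ⟩ := h
  refine isTwist_iff.mpr ⟨fun P Q => Ψ P Q, fun P Q => ⟨hπ P Q, fun a f => ?_⟩, fun f g => ?_⟩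
  · rw [hcomp, LinkingSystem.δSelf, hδ]
    rfl
  · rw [hcomp]
    exact ((congrArg (fun k => L'.comp k _) (L'.δCenter_zero hX _)).trans (L'.id_comp _)).symm

theorem IsTwist.trans {z z' : Cochain₂ (centerFunctor hX)} (h : IsTwist hX z L L')
    (h' : IsTwist hX z' L' L'') : IsTwist hX (z + z') L L'' := by
  obtain ⟨θ, hθ⟩ := isTwist_iff.mp h
  obtain ⟨θ', hθ'⟩ := isTwist_iff.mp h'
  refine isTwist_iff.mpr ⟨fun P Q f => θ' P Q (θ P Q f), fun P Q => ⟨fun f => ?_, fun a f => ?_⟩,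
    fun {P Q R} f g => ?_⟩
  · rw [(hθ'.equivariant P Q).π, (hθ.equivariant P Q).π]
  · rw [(hθ.equivariant P Q).δSelf_comp, (hθ'.equivariant P Q).δSelf_comp]
  · rw [hθ.map_comp, (hθ'.equivariant P R).δCenter_comp, hθ'.map_comp,
      (hθ.equivariant P Q).orbitMor, (hθ.equivariant Q R).orbitMor, L''.δCenter_add_assoc]
    rfl

theorem IsTwist.symm {z : Cochain₂ (centerFunctor hX)} (h : IsTwist hX z L L') :
    IsTwist hX (-z) L' L := by
  obtain ⟨θ, hθ⟩ := isTwist_iff.mp h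
  have hbij (P Q : X) := (hθ.equivariant P Q).bijective (hX := hX)
  choose η _ hη using fun P Q => Function.bijective_iff_has_inverse.mp (hbij P Q)
  have hη' (P Q : X) : IsEquivariant (η P Q) := by
    refine ⟨fun f => ?_, fun a f => (hbij P Q).1 ?_⟩
    · rw [← (hθ.equivariant P Q).π, hη]
    · rw [hη, (hθ.equivariant P Q).δSelf_comp, hη]
  refine isTwist_iff.mpr ⟨η, hη', fun {P Q R} f g => (hbij P R).1 ?_⟩
  rw [hη, (hθ.equivariant P R).δCenter_comp, hθ.map_comp, hη, hη, (hη' P Q).orbitMor,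
    (hη' Q R).orbitMor, L'.δCenter_add_assoc]
  simp only [Pi.neg_apply, neg_add_cancel]
  rw [L'.δCenter_zero, L'.id_comp]

theorem isTwist_d₁ (c : Cochain₁ (centerFunctor hX)) (L : F.LinkingSystem X) :
    IsTwist hX (d₁ _ c) L L := by
  refine isTwist_iff.mpr ⟨fun P Q f => L.comp (L.δCenter hX P (-c _ _ (L.orbitMor hX f))) f,
    fun P Q => ⟨fun f => L.π_δCenter_comp hX _ f, fun a f => ?_⟩, fun f g => ?_⟩
  · rw [L.orbitMor_δSelf_comp, L.δSelf_comp_δCenter]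
  · rw [L.δCenter_comp_comp, L.δCenter_add_assoc, L.orbitMor_comp]
    congr 2
    simp only [d₁, AddMonoidHom.coe_mk, ZeroHom.coe_mk, map_neg]
    abel

theorem IsTwistMap.comp_δSelf {z : Cochain₂ (centerFunctor hX)}
    {θ : ∀ P Q : X, L.Mor P Q → L'.Mor P Q} (hθ : IsTwistMap z θ) {P Q : X} (f : L.Mor P Q)
    (q : Q.1) : θ P Q (L.comp f (L.δSelf Q q)) = L'.comp (θ P Q f) (L'.δSelf Q q) := by
  have hδ : θ Q Q (L.δSelf Q q) = L'.comp (θ Q Q (L.id Q)) (L'.δSelf Q q) := by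
    have h := (hθ.equivariant Q Q).δSelf_comp q (L.id Q)
    rwa [L.comp_id, L'.δSelf_comp, (hθ.equivariant Q Q).π, L.π_id] at h
  rw [hθ.map_comp, hδ, L.orbitMor_δSelf, ← L.orbitMor_id, ← L'.assoc (θ P Q f), ← L'.assoc,
    ← hθ.map_comp, L.comp_id]

theorem IsTwist.mem_cocycle₂ {z : Cochain₂ (centerFunctor hX)} (h : IsTwist hX z L L') :
    z ∈ Cocycle₂ (centerFunctor hX) := by
  obtain ⟨θ, hθ⟩ := isTwist_iff.mp h
  refine cochain₃_ext fun P Q R T m n k => ?_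
  obtain ⟨f, rfl⟩ := L.orbitMor_surjective hX m
  obtain ⟨g, rfl⟩ := L.orbitMor_surjective hX n
  obtain ⟨e, rfl⟩ := L.orbitMor_surjective hX k
  have hassoc := congrArg (θ P T) (L.assoc f g e)
  rw [hθ.map_comp, hθ.map_comp f g, hθ.map_comp f, hθ.map_comp g e, L'.assoc, L'.assoc,
    L'.δCenter_add_assoc, L'.comp_δCenter_assoc, L'.δCenter_add_assoc, L.orbitMor_comp,
    L.orbitMor_comp, (hθ.equivariant P Q).orbitMor] at hassoc
  have hz := sub_eq_zero.mpr (L'.δCenter_comp_injective hX hassoc)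
  simp only [d₂, AddMonoidHom.coe_mk, ZeroHom.coe_mk, Pi.zero_apply]
  rw [← neg_eq_zero, ← hz]
  abel

theorem IsTwist.exists_d₁_eq {z : Cochain₂ (centerFunctor hX)} (h : IsTwist hX z L L) :
    ∃ c, d₁ _ c = z := by
  obtain ⟨θ, hθ⟩ := isTwist_iff.mp h
  choose s hs using fun P Q => L.orbitMor_surjective hX (P := P) (Q := Q)
  choose c hc using fun (P Q : X) (f : L.Mor P Q) =>
    L.exists_δCenter_comp hX ((hθ.equivariant P Q).π f).symm
  have hc_δSelf (P Q : X) (f : L.Mor P Q) (q : Q.1) :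
      c P Q (L.comp f (L.δSelf Q q)) = c P Q f := by
    have h := hθ.comp_δSelf f q
    rw [hc, hc P Q f, L.assoc] at h
    exact L.δCenter_comp_injective hX h
  have hcs (P Q : X) (f : L.Mor P Q) : c P Q f = c P Q (s P Q (L.orbitMor hX f)) :=
    L.eq_of_orbitMor_eq hX (hc_δSelf P Q) (hs P Q _).symm
  refine ⟨-extend₁ hX fun P Q m => c P Q (s P Q m), cochain₂_ext fun P Q R m n => ?_⟩
  obtain ⟨f, rfl⟩ := L.orbitMor_surjective hX m
  obtain ⟨g, rfl⟩ := L.orbitMor_surjective hX n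
  have hcomp := hθ.map_comp f g
  rw [hc, hc P Q f, hc Q R g, L.δCenter_comp_comp, L.δCenter_add_assoc] at hcomp
  simp only [d₁, AddMonoidHom.coe_mk, ZeroHom.coe_mk, Pi.neg_apply, extend₁_apply, map_neg]
  rw [← L.orbitMor_comp, ← hcs, ← hcs, ← hcs, L.δCenter_comp_injective hX hcomp]
  abel

theorem exists_map_comp_δSelf (hX : F.IsClosedFamily X) (L L' : F.LinkingSystem X) (P Q : X) :
    ∃ θ : L.Mor P Q → L'.Mor P Q, (∀ f, L'.π (θ f) = L.π f) ∧
      ∀ f q, θ (L.comp f (L.δSelf Q q)) = L'.comp (θ f) (L'.δSelf Q q) := by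
  choose s hs using L.orbitMor_surjective hX (P := P) (Q := Q)
  choose s' hs' using fun m => L'.π_surjective (L.π (s m))
  choose q hq using fun f : L.Mor P Q => L.exists_comp_δSelf hX (hs (L.orbitMor hX f))
  have hq_mul (f : L.Mor P Q) (r : Q.1) : q (L.comp f (L.δSelf Q r)) = r * q f := by
    apply L.comp_δSelf_injective hX (s (L.orbitMor hX f))
    rw [L.δSelf_mul, ← L.assoc, ← hq f]
    conv_rhs => rw [hq (L.comp f (L.δSelf Q r)), L.orbitMor_comp_δSelf]
  refine ⟨fun f => L'.comp (s' (L.orbitMor hX f)) (L'.δSelf Q (q f)), fun f => ?_, fun f r => ?_⟩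
  · refine Subtype.ext (MonoidHom.ext fun x => ?_)
    conv_rhs => rw [hq f]
    rw [L.π_comp_apply, L'.π_comp_apply, hs', L.π_δSelf_apply, L'.π_δSelf_apply]
  · dsimp only
    rw [hq_mul, L.orbitMor_comp_δSelf, L'.δSelf_mul, L'.assoc]

theorem exists_isTwist (hX : F.IsClosedFamily X) (L L' : F.LinkingSystem X) :
    ∃ z : Cochain₂ (centerFunctor hX), IsTwist hX z L L' := by
  choose θ hθπ hθδ using exists_map_comp_δSelf hX L L'
  have hθ (P Q : X) : IsEquivariant (θ P Q) :=
    ⟨hθπ P Q, fun a f => by rw [L.δSelf_comp, L'.δSelf_comp, hθδ, hθπ]⟩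
  choose w hw using fun (P Q R : X) (f : L.Mor P Q) (g : L.Mor Q R) =>
    L'.exists_δCenter_comp hX (f := L'.comp (θ P Q f) (θ Q R g)) (f' := θ P R (L.comp f g))
      (by rw [L'.π_comp, hθπ, hθπ, hθπ, L.π_comp])
  have hw_left (P Q R : X) (f : L.Mor P Q) (g : L.Mor Q R) (q : Q.1) :
      w P Q R (L.comp f (L.δSelf Q q)) g = w P Q R f g := by
    have h := hw P Q R (L.comp f (L.δSelf Q q)) g
    rw [L.assoc, L.δSelf_comp, ← L.assoc, hθδ, hθδ, L'.assoc (θ P Q f), L'.δSelf_comp, hθπ,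
      hw P Q R f g, L'.assoc, L'.assoc] at h
    exact (L'.δCenter_comp_injective hX h).symm
  have hw_right (P Q R : X) (f : L.Mor P Q) (g : L.Mor Q R) (r : R.1) :
      w P Q R f (L.comp g (L.δSelf R r)) = w P Q R f g := by
    have h := hw P Q R f (L.comp g (L.δSelf R r))
    rw [← L.assoc, hθδ, hθδ, hw P Q R f g, L'.assoc, L'.assoc] at h
    exact (L'.δCenter_comp_injective hX h).symm
  choose s hs using fun P Q => L.orbitMor_surjective hX (P := P) (Q := Q)
  refine ⟨extend₂ hX fun P Q R m n => w P Q R (s P Q m) (s Q R n),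
    isTwist_iff.mpr ⟨θ, hθ, fun {P Q R} f g => ?_⟩⟩
  have hws : w P Q R (s P Q (L.orbitMor hX f)) (s Q R (L.orbitMor hX g)) = w P Q R f g :=
    calc
      _ = w P Q R f (s Q R (L.orbitMor hX g)) :=
        L.eq_of_orbitMor_eq hX (c := fun k => w P Q R k _) (hw_left P Q R · _) (hs P Q _)
      _ = w P Q R f g := L.eq_of_orbitMor_eq hX (hw_right P Q R f) (hs Q R _)
  rw [extend₂_apply, hws, hw P Q R f g]

end Twist

end FusionSystem

namespace HigherLimits

variable {C : Type u} [SmallCategory C] {G : Cᵒᵖ ⥤ AddCommGrpCat.{u}} {z : Cochain₂ G}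

theorem map_add_of_mem_cocycle₂ (hz : z ∈ Cocycle₂ G) {P Q R T : C} (f : P ⟶ Q) (g : Q ⟶ R)
    (h : R ⟶ T) :
    G.map f.op (z _ _ _ g h) + z _ _ _ f (g ≫ h) = z _ _ _ (f ≫ g) h + z _ _ _ f g := by
  have hd : d₂ G z P Q R T f g h = 0 := by
    rw [AddMonoidHom.mem_ker.mp hz]
    rfl
  simp only [d₂, AddMonoidHom.coe_mk, ZeroHom.coe_mk] at hd
  rw [← sub_eq_zero, ← hd]
  abel

theorem cocycle₂_id_left (hz : z ∈ Cocycle₂ G) {P Q : C} (f : P ⟶ Q) :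
    z P P Q (𝟙 P) f = z P P P (𝟙 P) (𝟙 P) := by
  have h := map_add_of_mem_cocycle₂ hz (𝟙 P) (𝟙 P) f
  simp only [Category.id_comp, op_id, CategoryTheory.Functor.map_id, AddCommGrpCat.hom_id,
    AddMonoidHom.id_apply] at h
  exact add_left_cancel h

theorem cocycle₂_id_right (hz : z ∈ Cocycle₂ G) {P Q : C} (f : P ⟶ Q) :
    z P Q Q f (𝟙 Q) = G.map f.op (z Q Q Q (𝟙 Q) (𝟙 Q)) := by
  have h := map_add_of_mem_cocycle₂ hz f (𝟙 Q) (𝟙 Q)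
  rw [Category.comp_id, Category.comp_id] at h
  exact (add_right_cancel h).symm

end HigherLimits

namespace FusionSystem

variable {S : Type u} [Group S] {F : FusionSystem S} {X : Set (Subgroup S)}
  {hX : F.IsClosedFamily X} {L L' : F.LinkingSystem X}

namespace LinkingSystem

variable (L) (z : Cochain₂ (centerFunctor hX))

/-- The composition of `L` twisted by the inverse of a `2`-cochain. -/
noncomputable def twistComp {P Q R : X} (f : L.Mor P Q) (g : L.Mor Q R) : L.Mor P R :=
  L.comp (L.δCenter hX P (-z _ _ _ (L.orbitMor hX f) (L.orbitMor hX g))) (L.comp f g)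

/-- The elements of `P` as automorphisms for the twisted composition. -/
noncomputable def twistδ (P : X) (a : P.1) : L.Mor P P :=
  L.δSelf P (a * centerAtVal (z _ _ _ (𝟙 (hX.toOrbit P)) (𝟙 (hX.toOrbit P)) : CenterAt hX P))

theorem twistδ_eq (P : X) (a : P.1) : L.twistδ z P a =
    L.comp (L.δCenter hX P (z _ _ _ (𝟙 _) (𝟙 _))) (L.δSelf P a) :=
  L.δSelf_mul P _ _

theorem orbitMor_twistδ (P : X) (a : P.1) : L.orbitMor hX (L.twistδ z P a) = 𝟙 _ :=
  L.orbitMor_δSelf hX P _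

theorem orbitMor_twistComp {P Q R : X} (f : L.Mor P Q) (g : L.Mor Q R) :
    L.orbitMor hX (L.twistComp z f g) = L.orbitMor hX f ≫ L.orbitMor hX g :=
  (L.orbitMor_δSelf_comp hX _ _).trans (L.orbitMor_comp hX f g)

variable {z} (hz : z ∈ Cocycle₂ (centerFunctor hX))
include hz

theorem twistδ_twistComp {P Q : X} (a : P.1) (f : L.Mor P Q) :
    L.twistComp z (L.twistδ z P a) f = L.comp (L.δSelf P a) f := by
  rw [twistComp, orbitMor_twistδ, cocycle₂_id_left hz, twistδ_eq, L.assoc, L.δCenter_add_assoc,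
    neg_add_cancel, L.δCenter_zero, L.id_comp]

theorem twistComp_twistδ {P Q : X} (f : L.Mor P Q) (a : Q.1) :
    L.twistComp z f (L.twistδ z Q a) = L.comp f (L.δSelf Q a) := by
  rw [twistComp, orbitMor_twistδ, cocycle₂_id_right hz, twistδ_eq, L.comp_δCenter_assoc,
    L.δCenter_add_assoc, neg_add_cancel, L.δCenter_zero, L.id_comp]

theorem twistComp_assoc {P Q R T : X} (f : L.Mor P Q) (g : L.Mor Q R) (h : L.Mor R T) :
    L.twistComp z (L.twistComp z f g) h = L.twistComp z f (L.twistComp z g h) := by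
  rw [twistComp, orbitMor_twistComp, twistComp, L.assoc, L.δCenter_add_assoc, twistComp,
    orbitMor_twistComp, twistComp, L.comp_δCenter_assoc, L.δCenter_add_assoc, L.assoc]
  congr 2
  rw [map_neg, ← neg_add, ← neg_add, neg_inj]
  exact ((add_comm _ _).trans (map_add_of_mem_cocycle₂ hz _ _ _)).symm

/-- The linking system `L` with composition twisted by the inverse of a `2`-cocycle. -/
noncomputable def twist : F.PreLinkingSystem X where
  Mor := L.Mor
  comp := L.twistComp z
  assoc := L.twistComp_assoc hz
  π := L.π
  π_comp f g := (L.π_δCenter_comp hX _ _).trans (L.π_comp f g)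
  δ := L.twistδ z
  δ_mul P a b := by
    rw [L.twistδ_twistComp hz, twistδ, twistδ, ← L.δSelf_mul, mul_assoc, mul_assoc,
      mul_centerAtVal_comm]
  one_comp f := by rw [L.twistδ_twistComp hz, L.δSelf_one, L.id_comp]
  comp_one f := by rw [L.twistComp_twistδ hz, L.δSelf_one, L.comp_id]
  π_surjective := L.π_surjective
  free f a ha h := L.free f a ha ((L.twistδ_twistComp hz a f).symm.trans h)
  exists_of_π_eq f f' h := by
    obtain ⟨a, ha, h'⟩ := (L.π_eq_iff f f').mp h
    exact ⟨a, ha, h'.trans (L.twistδ_twistComp hz a f).symm⟩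
  π_δ P a x := by
    rw [twistδ, L.π_δSelf_apply, mul_assoc a, ← mul_centerAtVal_comm]
    group
  δ_comp f a := by rw [L.twistδ_twistComp hz, L.twistComp_twistδ hz, L.δSelf_comp]

end LinkingSystem

theorem exists_isTwist_left (hXne : X.Nonempty) (L : F.LinkingSystem X)
    {z : Cochain₂ (centerFunctor hX)} (hz : z ∈ Cocycle₂ (centerFunctor hX)) :
    ∃ L' : F.LinkingSystem X, IsTwist hX z L L' := by
  refine ⟨(L.twist hz).toLinkingSystem hXne hX, isTwist_iff.mpr
    ⟨fun P Q f => f, fun P Q => ⟨fun f => rfl, fun a f => ?_⟩, fun {P Q R} f g => ?_⟩⟩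
  · rw [PreLinkingSystem.toLinkingSystem_δSelf]
    exact (L.twistδ_twistComp hz a f).symm
  · rw [LinkingSystem.δCenter, PreLinkingSystem.toLinkingSystem_δSelf]
    refine Eq.trans ?_ (L.twistδ_twistComp hz _ (L.twistComp z f g)).symm
    change _ = L.comp (L.δCenter hX P _) (L.comp (L.δCenter hX P _) _)
    rw [L.δCenter_add_assoc, add_neg_cancel, L.δCenter_zero, L.id_comp]

namespace LinkingSystem

/-- The morphism of a linking system given by the inclusion of `P` in `S`. -/
def incl (L : F.LinkingSystem X) (hT : ⊤ ∈ X) (P : X) : L.Mor P ⟨⊤, hT⟩ :=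
  L.δ ⟨1, fun _ _ => Subgroup.mem_top _⟩

theorem incl_top (L : F.LinkingSystem X) (hT : ⊤ ∈ X) : L.incl hT ⟨⊤, hT⟩ = L.id _ := L.δ_one _

theorem δ_comp_incl (L : F.LinkingSystem X) (hT : ⊤ ∈ X) {P Q : X} (g : transporter P.1 Q.1) :
    L.comp (L.δ g) (L.incl hT Q) =
      L.comp (L.incl hT P) (L.δSelf ⟨⊤, hT⟩ ⟨g.1, Subgroup.mem_top _⟩) := by
  rw [incl, incl, δSelf, ← L.δ_mul, ← L.δ_mul]
  congr 1
  exact Subtype.ext ((one_mul _).trans (mul_one _).symm)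

end LinkingSystem

namespace IsTwistMap

variable {θ : ∀ P Q : X, L.Mor P Q → L'.Mor P Q}

theorem map_comp_of_zero (hθ : IsTwistMap (hX := hX) 0 θ) {P Q R : X} (f : L.Mor P Q)
    (g : L.Mor Q R) : θ P R (L.comp f g) = L'.comp (θ P Q f) (θ Q R g) := by
  rw [hθ.map_comp]
  exact (congrArg (fun k => L'.comp k _) (L'.δCenter_zero hX P)).trans (L'.id_comp _)

theorem map_id (hθ : IsTwistMap (hX := hX) 0 θ) (P : X) : θ P P (L.id P) = L'.id P := by
  apply L'.comp_right_cancel (g := θ P P (L.id P))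
  rw [← hθ.map_comp_of_zero, L.id_comp, L'.id_comp]

theorem conj (hθ : IsTwistMap (hX := hX) 0 θ) (w : ∀ P : X, CenterAt hX P) :
    IsTwistMap (hX := hX) 0 fun P Q f =>
      L'.comp (L'.δCenter hX P (w P)) (L'.comp (θ P Q f) (L'.δCenter hX Q (-w Q))) := by
  refine ⟨fun P Q => ⟨fun f => ?_, fun a f => ?_⟩, fun {P Q R} f g => ?_⟩
  · rw [L'.comp_δCenter, L'.π_δCenter_comp, L'.π_δCenter_comp, (hθ.equivariant P Q).π]
  · rw [(hθ.equivariant P Q).δSelf_comp, L'.assoc, L'.δSelf_comp_δCenter]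
  · refine Eq.trans ?_ ((congrArg (fun k => L'.comp k _) (L'.δCenter_zero hX P)).trans
      (L'.id_comp _)).symm
    rw [hθ.map_comp_of_zero, L'.assoc, L'.assoc, L'.assoc, L'.δCenter_add_assoc, neg_add_cancel,
      L'.δCenter_zero, L'.id_comp]

theorem iso_of_map_incl (hθ : IsTwistMap (hX := hX) 0 θ) (hT : ⊤ ∈ X)
    (hincl : ∀ P, θ P ⟨⊤, hT⟩ (L.incl hT P) = L'.incl hT P) : L.Iso L' := by
  have hθ_δSelf (g : (⊤ : Subgroup S)) : θ _ _ (L.δSelf ⟨⊤, hT⟩ g) = L'.δSelf ⟨⊤, hT⟩ g := by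
    rw [← L.comp_id (L.δSelf ⟨⊤, hT⟩ g), (hθ.equivariant _ _).δSelf_comp, hθ.map_id, L'.comp_id]
  refine ⟨fun P Q => Equiv.ofBijective (θ P Q) ((hθ.equivariant P Q).bijective (hX := hX)),
    hθ.map_id, fun P Q R => hθ.map_comp_of_zero, fun P Q => (hθ.equivariant P Q).π,
    fun P Q g => ?_⟩
  apply L'.comp_right_cancel (g := L'.incl hT Q)
  rw [Equiv.ofBijective_apply, L'.δ_comp_incl, ← hincl, ← hθ.map_comp_of_zero, L.δ_comp_incl,
    hθ.map_comp_of_zero, hincl, hθ_δSelf]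

end IsTwistMap

theorem IsTwist.iso (hXne : X.Nonempty) (h : IsTwist hX 0 L L') : L.Iso L' := by
  obtain ⟨θ, hθ⟩ := isTwist_iff.mp h
  have hT : ⊤ ∈ X := hX.top_mem hXne
  choose w hw using fun P => L'.exists_δCenter_comp hX
    (f := θ P ⟨⊤, hT⟩ (L.incl hT P)) (f' := L'.incl hT P) (by
      rw [(hθ.equivariant _ _).π, LinkingSystem.incl, LinkingSystem.incl, L.π_δ, L'.π_δ])
  have hwT : w ⟨⊤, hT⟩ = 0 := by
    apply L'.δCenter_comp_injective hX (f := θ _ _ (L.incl hT ⟨⊤, hT⟩))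
    rw [← hw, L'.δCenter_zero, L'.id_comp, L.incl_top, L'.incl_top, hθ.map_id]
  refine (hθ.conj w).iso_of_map_incl hT fun P => ?_
  rw [hwT, neg_zero, L'.δCenter_zero, L'.comp_id, ← hw]

end FusionSystem

namespace FusionSystem

variable {S : Type u} [Group S] {F : FusionSystem S} {X : Set (Subgroup S)}
  {hX : F.IsClosedFamily X}

/-! ### The action of second cohomology -/

theorem class₂_eq_iff {z z' : Cocycle₂ (centerFunctor hX)} :
    class₂ z = class₂ z' ↔ ∃ c, d₁ _ c = z'.1 - z.1 := by
  rw [class₂, class₂, QuotientAddGroup.eq, AddSubgroup.mem_addSubgroupOf, neg_add_eq_sub]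
  rfl

theorem exists_class₂_eq (a : BarH₂ (centerFunctor hX)) : ∃ z, class₂ z = a :=
  QuotientAddGroup.mk_surjective a

theorem toClass_eq_iff_isTwist (hXne : X.Nonempty) {L L' : F.LinkingSystem X} :
    L.toClass = L'.toClass ↔ IsTwist hX 0 L L' :=
  ⟨fun h => LinkingSystem.Iso.isTwist_zero hX (Quotient.exact h),
    fun h => Quotient.sound (h.iso hXne)⟩

/-- The class `y` of linking systems is the twist of the class `x` by the cohomology class `a`. -/
def IsTwistClass (a : BarH₂ (centerFunctor hX)) (x y : F.LinkingClasses X) : Prop :=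
  ∃ (z : Cocycle₂ (centerFunctor hX)) (L L' : F.LinkingSystem X),
    class₂ z = a ∧ L.toClass = x ∧ L'.toClass = y ∧ IsTwist hX z.1 L L'

theorem isTwistClass_iff (hXne : X.Nonempty) {z : Cocycle₂ (centerFunctor hX)}
    {L L' : F.LinkingSystem X} :
    IsTwistClass (class₂ z) L.toClass L'.toClass ↔ IsTwist hX z.1 L L' := by
  refine ⟨fun ⟨z₀, L₀, L₀', hz, hL, hL', h⟩ => ?_, fun h => ⟨z, L, L', rfl, rfl, rfl, h⟩⟩
  obtain ⟨c, hc⟩ := class₂_eq_iff.mp hz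
  have h' := ((toClass_eq_iff_isTwist hXne).mp hL.symm).trans
    (((isTwist_d₁ c L₀).trans h).trans ((toClass_eq_iff_isTwist hXne).mp hL'))
  rwa [hc, sub_add_cancel, zero_add, add_zero] at h'

theorem isTwistClass_zero_iff (hXne : X.Nonempty) {x y : F.LinkingClasses X} :
    IsTwistClass (0 : BarH₂ (centerFunctor hX)) x y ↔ x = y := by
  obtain ⟨L, rfl⟩ := Quotient.exists_rep x
  obtain ⟨L', rfl⟩ := Quotient.exists_rep y
  exact (isTwistClass_iff hXne (z := 0)).trans (toClass_eq_iff_isTwist hXne).symm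

theorem IsTwistClass.trans (hXne : X.Nonempty) {a b : BarH₂ (centerFunctor hX)}
    {x y w : F.LinkingClasses X} (h : IsTwistClass a x y) (h' : IsTwistClass b y w) :
    IsTwistClass (a + b) x w := by
  obtain ⟨z, L, L', rfl, rfl, rfl, hL⟩ := h
  obtain ⟨z', rfl⟩ := exists_class₂_eq b
  obtain ⟨L'', rfl⟩ := Quotient.exists_rep w
  exact ⟨z + z', L, L'', rfl, rfl, rfl, hL.trans ((isTwistClass_iff hXne).mp h')⟩

theorem IsTwistClass.symm {a : BarH₂ (centerFunctor hX)} {x y : F.LinkingClasses X}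
    (h : IsTwistClass a x y) : IsTwistClass (-a) y x := by
  obtain ⟨z, L, L', rfl, rfl, rfl, hL⟩ := h
  exact ⟨-z, L', L, rfl, rfl, rfl, hL.symm⟩

theorem IsTwistClass.eq_zero (hXne : X.Nonempty) {a : BarH₂ (centerFunctor hX)}
    {x : F.LinkingClasses X} (h : IsTwistClass a x x) : a = 0 := by
  obtain ⟨z, rfl⟩ := exists_class₂_eq a
  obtain ⟨L, rfl⟩ := Quotient.exists_rep x
  obtain ⟨c, hc⟩ := ((isTwistClass_iff hXne).mp h).exists_d₁_eq
  exact (class₂_eq_iff.mpr ⟨c, by rw [hc]; exact (sub_zero _).symm⟩ : class₂ 0 = class₂ z).symm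

theorem exists_isTwistClass (x y : F.LinkingClasses X) :
    ∃ a : BarH₂ (centerFunctor hX), IsTwistClass a x y := by
  obtain ⟨L, rfl⟩ := Quotient.exists_rep x
  obtain ⟨L', rfl⟩ := Quotient.exists_rep y
  obtain ⟨z, hz⟩ := exists_isTwist hX L L'
  exact ⟨_, ⟨z, hz.mem_cocycle₂⟩, L, L', rfl, rfl, rfl, hz⟩

theorem existsUnique_isTwistClass (hXne : X.Nonempty) (a : BarH₂ (centerFunctor hX))
    (x : F.LinkingClasses X) : ∃! y, IsTwistClass a x y := by
  obtain ⟨z, rfl⟩ := exists_class₂_eq a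
  obtain ⟨L, rfl⟩ := Quotient.exists_rep x
  obtain ⟨L', hL'⟩ := exists_isTwist_left hXne L z.2
  have h : IsTwistClass (class₂ z) L.toClass L'.toClass := (isTwistClass_iff hXne).mpr hL'
  refine ⟨L'.toClass, h, fun y hy => ?_⟩
  have h0 := IsTwistClass.trans hXne hy.symm h
  rwa [neg_add_cancel, isTwistClass_zero_iff hXne] at h0

/-- The action of the second cohomology group of the bar complex on the isomorphism classes of
linking systems. -/
noncomputable abbrev twistAction (hXne : X.Nonempty) :
    AddAction (BarH₂ (centerFunctor hX)) (F.LinkingClasses X) where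
  vadd a x := (existsUnique_isTwistClass hXne a x).choose
  zero_vadd x := ((existsUnique_isTwistClass hXne 0 x).choose_eq_iff).mpr
    ((isTwistClass_zero_iff hXne).mpr rfl)
  add_vadd a b x := ((existsUnique_isTwistClass hXne (a + b) x).choose_eq_iff).mpr <|
    add_comm b a ▸ IsTwistClass.trans hXne (existsUnique_isTwistClass hXne b x).choose_spec.1
      (existsUnique_isTwistClass hXne a _).choose_spec.1

theorem twistAction_vadd_eq_iff (hXne : X.Nonempty) {a : BarH₂ (centerFunctor hX)}
    {x y : F.LinkingClasses X} : (twistAction hXne).vadd a x = y ↔ IsTwistClass a x y :=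
  (existsUnique_isTwistClass hXne a x).choose_eq_iff

theorem exists_addAction (hXne : X.Nonempty) {H : Type*} [AddCommGroup H]
    (e : BarH₂ (centerFunctor hX) ≃+ H) :
    ∃ act : AddAction H (F.LinkingClasses X),
      (∀ (z : Cocycle₂ (centerFunctor hX)) (L L' : F.LinkingSystem X),
        act.vadd (e (class₂ z)) L.toClass = L'.toClass ↔ IsTwist hX z.1 L L') ∧
      (∀ (a : H) (x : F.LinkingClasses X), act.vadd a x = x → a = 0) ∧
      (∀ x y : F.LinkingClasses X, ∃ a : H, act.vadd a x = y) := by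
  let twist := twistAction hXne (hX := hX)
  let act := AddAction.compHom (F.LinkingClasses X) (e.symm : H →+ BarH₂ (centerFunctor hX))
  have vadd_eq_iff {a x y} : act.vadd a x = y ↔ IsTwistClass (e.symm a) x y :=
    twistAction_vadd_eq_iff hXne
  refine ⟨act, fun z L L' => ?_, fun a x h => ?_, fun x y => ?_⟩
  · rw [vadd_eq_iff, e.symm_apply_apply, isTwistClass_iff hXne]
  · exact e.symm.map_eq_zero_iff.mp ((vadd_eq_iff.mp h).eq_zero hXne)
  · obtain ⟨a, ha⟩ := exists_isTwistClass (hX := hX) x y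
    exact ⟨e a, vadd_eq_iff.mpr (by rwa [e.symm_apply_apply])⟩

theorem nonempty_equiv_of_free_of_transitive {H α : Type*} [AddGroup H] [Nonempty α]
    (act : AddAction H α) (hfree : ∀ (a : H) (x : α), act.vadd a x = x → a = 0)
    (htrans : ∀ x y : α, ∃ a : H, act.vadd a x = y) : Nonempty (H ≃ α) := by
  obtain ⟨x⟩ := ‹Nonempty α›
  refine ⟨Equiv.ofBijective (fun a => a +ᵥ x) ⟨fun a b (hab : a +ᵥ x = b +ᵥ x) => ?_, htrans x⟩⟩
  refine (neg_add_eq_zero.mp (hfree (-b + a) x ?_)).symm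
  rw [← neg_vadd_eq_iff] at hab
  exact (add_vadd (-b) a x).trans hab

end FusionSystem

namespace FusionSystem

variable {S : Type u} [Group S] {F : FusionSystem S} {X : Set (Subgroup S)}

/-! ### Lifts of the orbit category and their defects -/

/-- A lift of the orbit category to the fusion system, as used to define the obstruction class:
representatives `σ f` of the orbit morphisms, and elements `t f g` which conjugate the
representative of a composite to the composite of the representatives. -/
structure OrbitLift (F : FusionSystem S) where
  σ {P Q : F.OrbitCategory F.centric} (f : P ⟶ Q) : F.Hom P.obj Q.obj
  t {P Q R : F.OrbitCategory F.centric} (f : P ⟶ Q) (g : Q ⟶ R) : R.obj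
  orbitClass_σ {P Q : F.OrbitCategory F.centric} (f : P ⟶ Q) : F.orbitClass (σ f) = f
  comm {P Q R : F.OrbitCategory F.centric} (f : P ⟶ Q) (g : Q ⟶ R) (x : P.obj) :
    (σ g).1 ((σ f).1 x) * t f g = t f g * (σ (f ≫ g)).1 x

instance : Nonempty F.OrbitLift := by
  have h {P Q : F.OrbitCategory F.centric} (f : P ⟶ Q) :
      ∃ φ : F.Hom P.obj Q.obj, F.orbitClass φ = f := Quotient.exists_rep f
  choose σ hσ using @h
  have h' {P Q R : F.OrbitCategory F.centric} (f : P ⟶ Q) (g : Q ⟶ R) :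
      ∃ t : R.obj, ∀ x, (σ g).1 ((σ f).1 x) = t * (σ (f ≫ g)).1 x * t⁻¹ := by
    refine orbitClass_eq_iff.mp (?_ : _ = F.orbitClass (F.homComp (σ f) (σ g)))
    rw [orbitClass_homComp, hσ, hσ, hσ]
  choose t ht using @h'
  exact ⟨⟨σ, t, hσ, fun f g x => by rw [ht, inv_mul_cancel_right]⟩⟩

namespace OrbitLift

/-- The cochain `u` measures the failure of associativity of the lift `A`. -/
def IsDefect (hX : F.IsClosedFamily X) (A : F.OrbitLift) (u : Cochain₃ (centerFunctor hX)) :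
    Prop :=
  ∀ ⦃P Q R T : F.OrbitCategory F.centric⦄ (f : P ⟶ Q) (g : Q ⟶ R) (h : R ⟶ T), P.obj ∈ X →
    (A.σ h).1 (A.t f g) * A.t (f ≫ g) h =
      A.t g h * A.t f (g ≫ h) * (A.σ (f ≫ g ≫ h)).1 (centerVal (u P Q R T f g h))

variable {hX : F.IsClosedFamily X} {A : F.OrbitLift} {u u' : Cochain₃ (centerFunctor hX)}
  {P Q R T : F.OrbitCategory F.centric}

theorem comm_comp (A : F.OrbitLift) (f : P ⟶ Q) (g : Q ⟶ R) (h : R ⟶ T) (x : P.obj) :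
    (A.σ h).1 ((A.σ (f ≫ g)).1 x) * A.t (f ≫ g) h =
      A.t (f ≫ g) h * (A.σ (f ≫ g ≫ h)).1 x := by
  rw [A.comm, Category.assoc]

theorem comm_centerVal (A : F.OrbitLift) (hP : P.obj ∈ X) (f : P ⟶ Q) (g : Q ⟶ R)
    (x : (centerFunctor hX).obj (op Q)) :
    (A.σ g).1 (centerVal x) * A.t f g =
      A.t f g * (A.σ (f ≫ g)).1 (centerVal ((centerFunctor hX).map f.op x)) := by
  rw [← A.comm, apply_centerVal_map hP (A.orbitClass_σ f)]

/-! ### The obstruction cocycle -/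

theorem exists_isDefect (hX : F.IsClosedFamily X) (A : F.OrbitLift) : ∃ u, A.IsDefect hX u := by
  have h (P Q R T : F.OrbitCategory F.centric) (f : P ⟶ Q) (g : Q ⟶ R) (h : R ⟶ T) :
      ∃ u : (centerFunctor hX).obj (op P), P.obj ∈ X →
        (A.σ h).1 (A.t f g) * A.t (f ≫ g) h =
          A.t g h * A.t f (g ≫ h) * (A.σ (f ≫ g ≫ h)).1 (centerVal u) := by
    by_cases hP : P.obj ∈ X
    · obtain ⟨z, hz, h'⟩ := exists_mem_center_of_conj_eq P.mem (A.σ (f ≫ g ≫ h))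
        (a := (A.σ h).1 (A.t f g) * A.t (f ≫ g) h) (b := A.t g h * A.t f (g ≫ h))
        (ψ := fun x => (A.σ h).1 ((A.σ g).1 ((A.σ f).1 x)))
        (fun x => by
          rw [← mul_assoc, ← map_mul, A.comm f g, map_mul, mul_assoc, A.comm_comp, mul_assoc])
        (fun x => by rw [← mul_assoc, A.comm g h, mul_assoc, A.comm f, mul_assoc])
      obtain ⟨u, rfl⟩ := exists_centerVal_eq (hX := hX) hP hz
      exact ⟨u, fun _ => h'⟩
    · exact ⟨0, fun h => absurd h hP⟩
  choose u hu using h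
  exact ⟨u, fun _ _ _ _ => hu _ _ _ _⟩

theorem IsDefect.unique (h : A.IsDefect hX u) (h' : A.IsDefect hX u') : u = u' :=
  funext₃ fun _ _ _ => funext₃ fun _ f g => funext fun k => centerVal_ext fun hP =>
    F.injective (A.σ _).2 (mul_left_cancel ((h f g k hP).symm.trans (h' f g k hP)))

/-- The five faces of the associativity pentagon. The composite of four orbit morphisms
`f, g, h, k` leads to this situation with `a = σ_k(σ_h(t(f, g)))`, `b = σ_k(t(fg, h))` and so on;
the `sᵢ` are the values of the defect. -/
theorem mul_eq_mul_of_pentagon {G : Type*} [Group G]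
    {a b c d e m n p q r v w y s₀ s₁ s₂ s₃ s₄ : G}
    (face_fgh : a * b = c * d * e) (face_f_gh_k : d * y = m * n * s₂)
    (face_ghk : c * m = p * q * r) (face_fg_h_k : b * y = p * w * s₁)
    (face_f_g_hk : v * w = q * n * s₃) (comm_e : e * y = y * s₄) (comm_a : a * p = p * v)
    (comm_r : r * n = n * s₀) : s₀ * s₂ * s₄ = s₃ * s₁ := by
  apply mul_left_cancel (a := p * q * n)
  calc p * q * n * (s₀ * s₂ * s₄) = p * q * (n * s₀) * s₂ * s₄ := by simp only [mul_assoc]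
    _ = p * q * r * n * s₂ * s₄ := by rw [← comm_r]; simp only [mul_assoc]
    _ = c * (m * n * s₂) * s₄ := by rw [← face_ghk]; simp only [mul_assoc]
    _ = c * d * (y * s₄) := by rw [← face_f_gh_k]; simp only [mul_assoc]
    _ = c * d * e * y := by rw [← comm_e]; simp only [mul_assoc]
    _ = a * (b * y) := by rw [← face_fgh, mul_assoc]
    _ = a * p * w * s₁ := by rw [face_fg_h_k]; simp only [mul_assoc]
    _ = p * (v * w) * s₁ := by rw [comm_a]; simp only [mul_assoc]
    _ = p * q * n * (s₃ * s₁) := by rw [face_f_g_hk]; simp only [mul_assoc]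

theorem IsDefect.mem_cocycle₃ (hu : A.IsDefect hX u) : u ∈ Cocycle₃ (centerFunctor hX) := by
  funext P Q R T U f g h k
  refine centerVal_ext fun hP => ?_
  have face_fgh := congrArg (A.σ k).1 (hu f g h hP)
  have face_fg_h_k := hu (f ≫ g) h k hP
  have comm_u := A.comm_comp f (g ≫ h) k (centerVal (u P Q R T f g h))
  simp only [Category.assoc, map_mul] at face_fgh face_fg_h_k comm_u
  have face_f_gh_k := hu f (g ≫ h) k hP
  rw [Category.assoc] at face_f_gh_k
  have pentagon := mul_eq_mul_of_pentagon face_fgh face_f_gh_k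
    (hu g h k (mem_of_orbitHom hX f hP)) face_fg_h_k (hu f g (h ≫ k) hP) comm_u
    (A.comm h k (A.t f g)) (A.comm_centerVal hP f (g ≫ h ≫ k) (u Q R T U g h k))
  simp only [← map_mul, ← centerVal_add] at pentagon
  have hd := centerVal_ext (hX := hX) fun _ => F.injective (A.σ _).2 pentagon
  congr 1
  simp only [d₃, AddMonoidHom.coe_mk, ZeroHom.coe_mk, Pi.zero_apply]
  rw [← sub_eq_zero.mpr hd]
  abel

/-- The lift obtained by multiplying the elements `t f g` by central elements. -/
def mulCenter (A : F.OrbitLift) (c : Cochain₂ (centerFunctor hX)) : F.OrbitLift where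
  σ := A.σ
  t f g := A.t f g * (A.σ (f ≫ g)).1 (centerVal (c _ _ _ f g))
  orbitClass_σ := A.orbitClass_σ
  comm f g x := by
    rw [← mul_assoc, A.comm, mul_assoc, mul_assoc, ← map_mul, ← map_mul,
      Subgroup.mem_center_iff.mp (centerVal_mem_center _)]

theorem IsDefect.mulCenter (hu : A.IsDefect hX u) (c : Cochain₂ (centerFunctor hX)) :
    (A.mulCenter c).IsDefect hX (u - d₂ _ c) := by
  intro P Q R T f g h hP
  set s := (A.σ (f ≫ g ≫ h)).1 with hs
  have hc : u P Q R T f g h + c P Q R f g + c P R T (f ≫ g) h =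
      (centerFunctor hX).map f.op (c Q R T g h) + c P Q T f (g ≫ h) +
        (u - d₂ _ c) P Q R T f g h := by
    simp only [d₂, AddMonoidHom.coe_mk, ZeroHom.coe_mk, Pi.sub_apply]
    abel
  calc (A.σ h).1 (A.t f g * (A.σ (f ≫ g)).1 (centerVal (c P Q R f g))) *
        (A.t (f ≫ g) h * (A.σ ((f ≫ g) ≫ h)).1 (centerVal (c P R T (f ≫ g) h)))
      = (A.σ h).1 (A.t f g) * ((A.σ h).1 ((A.σ (f ≫ g)).1 (centerVal (c P Q R f g))) *
          A.t (f ≫ g) h) * s (centerVal (c P R T (f ≫ g) h)) := by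
        rw [hs, Category.assoc, map_mul]
        simp only [mul_assoc]
    _ = A.t g h * A.t f (g ≫ h) *
          s (centerVal (u P Q R T f g h + c P Q R f g + c P R T (f ≫ g) h)) := by
        rw [A.comm_comp, ← mul_assoc, hu f g h hP]
        simp only [hs, centerVal_add, map_mul, mul_assoc]
    _ = A.t g h * (A.t f (g ≫ h) * s (centerVal ((centerFunctor hX).map f.op (c Q R T g h)))) *
          s (centerVal (c P Q T f (g ≫ h))) * s (centerVal ((u - d₂ _ c) P Q R T f g h)) := by
        rw [hc]
        simp only [centerVal_add, map_mul, mul_assoc]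
    _ = A.t g h * (A.σ (g ≫ h)).1 (centerVal (c Q R T g h)) *
          (A.t f (g ≫ h) * s (centerVal (c P Q T f (g ≫ h)))) *
          s (centerVal ((u - d₂ _ c) P Q R T f g h)) := by
        rw [hs, ← A.comm_centerVal hP]
        simp only [mul_assoc]

/-- The lift obtained by conjugating the representatives `σ f` by elements `q f`. -/
def conj (A : F.OrbitLift) (σ : ∀ {P Q : F.OrbitCategory F.centric}, (P ⟶ Q) → F.Hom P.obj Q.obj)
    (q : ∀ {P Q : F.OrbitCategory F.centric}, (P ⟶ Q) → Q.obj)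
    (hσ : ∀ {P Q : F.OrbitCategory F.centric} (f : P ⟶ Q) (x : P.obj),
      (σ f).1 x = q f * (A.σ f).1 x * (q f)⁻¹) : F.OrbitLift where
  σ := σ
  t f g := q g * (A.σ g).1 (q f) * A.t f g * (q (f ≫ g))⁻¹
  orbitClass_σ f := (orbitClass_eq_iff.mpr ⟨q f, hσ f⟩).symm.trans (A.orbitClass_σ f)
  comm f g x := by
    have h := A.comm f g x
    simp only [hσ, map_mul, map_inv, mul_assoc, inv_mul_cancel_left]
    simp only [← mul_assoc] at h ⊢
    rw [mul_assoc _ _ (A.t f g), h]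
    simp only [mul_assoc]

theorem IsDefect.conj (hu : A.IsDefect hX u)
    {σ : ∀ {P Q : F.OrbitCategory F.centric}, (P ⟶ Q) → F.Hom P.obj Q.obj}
    {q : ∀ {P Q : F.OrbitCategory F.centric}, (P ⟶ Q) → Q.obj}
    (hσ : ∀ {P Q : F.OrbitCategory F.centric} (f : P ⟶ Q) (x : P.obj),
      (σ f).1 x = q f * (A.σ f).1 x * (q f)⁻¹) : (A.conj σ q hσ).IsDefect hX u := by
  intro P Q R T f g h hP
  have hq := A.comm g h (q f)
  simp only [OrbitLift.conj, hσ, map_mul, map_inv, mul_assoc, inv_mul_cancel_left, Category.assoc]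
  rw [← mul_assoc (A.t g h) ((A.σ (g ≫ h)).1 _), ← hq, ← mul_assoc ((A.σ h).1 (A.t f g)),
    hu f g h hP]
  simp only [mul_assoc]

theorem IsDefect.congr {B : F.OrbitLift} (hu : A.IsDefect hX u)
    (hσ : ∀ {P Q : F.OrbitCategory F.centric} (f : P ⟶ Q), B.σ f = A.σ f)
    (ht : ∀ {P Q R : F.OrbitCategory F.centric} (f : P ⟶ Q) (g : Q ⟶ R), P.obj ∈ X →
      B.t f g = A.t f g) : B.IsDefect hX u := by
  intro P Q R T f g h hP
  simp only [hσ, ht _ _ hP, ht _ _ (mem_of_orbitHom hX f hP), hu f g h hP]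

variable (hX) in
theorem exists_mulCenter_t_eq {A B : F.OrbitLift}
    (hσ : ∀ {P Q : F.OrbitCategory F.centric} (f : P ⟶ Q), B.σ f = A.σ f) :
    ∃ c : Cochain₂ (centerFunctor hX), ∀ {P Q R : F.OrbitCategory F.centric} (f : P ⟶ Q)
      (g : Q ⟶ R), P.obj ∈ X → B.t f g = (A.mulCenter c).t f g := by
  have h (P Q R : F.OrbitCategory F.centric) (f : P ⟶ Q) (g : Q ⟶ R) :
      ∃ c : (centerFunctor hX).obj (op P), P.obj ∈ X →
        B.t f g = A.t f g * (A.σ (f ≫ g)).1 (centerVal c) := by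
    by_cases hP : P.obj ∈ X
    · obtain ⟨z, hz, h⟩ := exists_mem_center_of_conj_eq P.mem (A.σ (f ≫ g))
        (a := B.t f g) (fun x => by rw [← hσ (f ≫ g), ← B.comm, hσ, hσ]) (A.comm f g)
      obtain ⟨c, rfl⟩ := exists_centerVal_eq (hX := hX) hP hz
      exact ⟨c, fun _ => h⟩
    · exact ⟨0, fun h => absurd h hP⟩
  choose c hc using h
  exact ⟨c, hc _ _ _⟩

theorem IsDefect.exists_d₂_eq {B : F.OrbitLift} (hu : A.IsDefect hX u) (hu' : B.IsDefect hX u') :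
    ∃ c, d₂ _ c = u - u' := by
  have h {P Q : F.OrbitCategory F.centric} (f : P ⟶ Q) :
      ∃ q : Q.obj, ∀ x, (B.σ f).1 x = q * (A.σ f).1 x * q⁻¹ :=
    orbitClass_eq_iff.mp ((A.orbitClass_σ f).trans (B.orbitClass_σ f).symm)
  choose q hq using @h
  obtain ⟨c, hc⟩ := exists_mulCenter_t_eq hX (A := A.conj B.σ q hq) (B := B) fun _ => rfl
  have hB : B.IsDefect hX (u - d₂ _ c) := ((hu.conj hq).mulCenter c).congr (fun _ => rfl) hc
  exact ⟨c, by rw [hu'.unique hB, sub_sub_cancel]⟩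

end OrbitLift

theorem isObstructionCochain_iff {hX : F.IsClosedFamily X} {u : Cochain₃ (centerFunctor hX)} :
    IsObstructionCochain hX u ↔ ∃ A : F.OrbitLift, A.IsDefect hX u :=
  ⟨fun ⟨σ, t, hσ, ht, hu⟩ => ⟨⟨fun f => σ _ _ f, fun f g => t _ _ _ f g, hσ _ _, fun f g x => by
      rw [ht, inv_mul_cancel_right]⟩, hu⟩,
    fun ⟨A, hu⟩ => ⟨fun _ _ => A.σ, fun _ _ _ => A.t, fun _ _ => A.orbitClass_σ,
      fun _ _ _ f g x => eq_mul_inv_of_mul_eq (A.comm f g x), hu⟩⟩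

theorem exists_isObstructionCochain (hX : F.IsClosedFamily X) :
    ∃ u, IsObstructionCochain hX u := by
  obtain ⟨A⟩ : Nonempty F.OrbitLift := inferInstance
  obtain ⟨u, hu⟩ := A.exists_isDefect hX
  exact ⟨u, isObstructionCochain_iff.mpr ⟨A, hu⟩⟩

namespace IsObstructionCochain

variable {hX : F.IsClosedFamily X} {u u' : Cochain₃ (centerFunctor hX)}

theorem mem_cocycle₃ (h : IsObstructionCochain hX u) : u ∈ Cocycle₃ (centerFunctor hX) := by
  obtain ⟨A, hu⟩ := isObstructionCochain_iff.mp h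
  exact hu.mem_cocycle₃

theorem class₃_eq (h : IsObstructionCochain hX u) (h' : IsObstructionCochain hX u') :
    class₃ ⟨u, h.mem_cocycle₃⟩ = class₃ ⟨u', h'.mem_cocycle₃⟩ := by
  obtain ⟨A, hu⟩ := isObstructionCochain_iff.mp h
  obtain ⟨B, hu'⟩ := isObstructionCochain_iff.mp h'
  rw [class₃, class₃, QuotientAddGroup.eq, AddSubgroup.mem_addSubgroupOf, neg_add_eq_sub]
  exact hu'.exists_d₂_eq hu

theorem zero_of_class₃_eq_zero (h : IsObstructionCochain hX u)
    (h0 : class₃ ⟨u, h.mem_cocycle₃⟩ = 0) : IsObstructionCochain hX 0 := by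
  rw [class₃, QuotientAddGroup.eq_zero_iff, AddSubgroup.mem_addSubgroupOf] at h0
  obtain ⟨c, hc⟩ := h0
  obtain ⟨A, hu⟩ := isObstructionCochain_iff.mp h
  refine isObstructionCochain_iff.mpr ⟨A.mulCenter c, ?_⟩
  simpa only [hc, sub_self] using hu.mulCenter c

end IsObstructionCochain

/-! ### Linking systems give vanishing obstruction cochains -/

namespace LinkingSystem

variable (L : F.LinkingSystem X) {hX : F.IsClosedFamily X} {A : F.OrbitLift}
  {s : ∀ {P Q : F.OrbitCategory F.centric} (hP : P.obj ∈ X) (hQ : Q.obj ∈ X), (P ⟶ Q) →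
    L.Mor ⟨P.obj, hP⟩ ⟨Q.obj, hQ⟩}

variable (hX) in
theorem exists_mulCenter_comp_eq (hs : ∀ {P Q : F.OrbitCategory F.centric} (hP : P.obj ∈ X)
      (hQ : Q.obj ∈ X) (f : P ⟶ Q), L.π (s hP hQ f) = A.σ f) :
    ∃ c : Cochain₂ (centerFunctor hX), ∀ {P Q R : F.OrbitCategory F.centric} (hP : P.obj ∈ X)
      (hQ : Q.obj ∈ X) (hR : R.obj ∈ X) (f : P ⟶ Q) (g : Q ⟶ R),
        L.comp (s hP hQ f) (s hQ hR g) =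
          L.comp (s hP hR (f ≫ g)) (L.δSelf ⟨R.obj, hR⟩ ((A.mulCenter c).t f g)) := by
  have h (P Q R : F.OrbitCategory F.centric) (f : P ⟶ Q) (g : Q ⟶ R) :
      ∃ c : (centerFunctor hX).obj (op P), ∀ (hP : P.obj ∈ X) (hQ : Q.obj ∈ X) (hR : R.obj ∈ X),
        L.comp (s hP hQ f) (s hQ hR g) = L.comp (s hP hR (f ≫ g))
          (L.δSelf ⟨R.obj, hR⟩ (A.t f g * (A.σ (f ≫ g)).1 (centerVal c))) := by
    by_cases hP : P.obj ∈ X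
    · have hQ := mem_of_orbitHom hX f hP
      have hR := mem_of_orbitHom hX g hQ
      have hπ : L.π (L.comp (s hP hR (f ≫ g)) (L.δSelf ⟨R.obj, hR⟩ (A.t f g))) =
          L.π (L.comp (s hP hQ f) (s hQ hR g)) := by
        apply Subtype.ext
        ext1 x
        rw [π_comp_apply, π_comp_apply, π_δSelf_apply, hs, hs, hs]
        exact mul_inv_eq_of_eq_mul (A.comm f g x).symm
      obtain ⟨z, hz, h⟩ := (L.π_eq_iff _ _).mp hπ
      obtain ⟨c, rfl⟩ := exists_centerVal_eq (hX := hX) hP hz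
      refine ⟨c, fun _ _ _ => h.trans ?_⟩
      rw [δSelf_mul, ← assoc, ← assoc, ← hs hP hR, ← δSelf_comp]
      rfl
    · exact ⟨0, fun h => absurd h hP⟩
  choose c hc using h
  exact ⟨c, fun hP hQ hR f g => hc _ _ _ f g hP hQ hR⟩

theorem isDefect_zero (hs : ∀ {P Q : F.OrbitCategory F.centric} (hP : P.obj ∈ X)
      (hQ : Q.obj ∈ X) (f : P ⟶ Q), L.π (s hP hQ f) = A.σ f)
    (hcomp : ∀ {P Q R : F.OrbitCategory F.centric} (hP : P.obj ∈ X) (hQ : Q.obj ∈ X)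
      (hR : R.obj ∈ X) (f : P ⟶ Q) (g : Q ⟶ R), L.comp (s hP hQ f) (s hQ hR g) =
        L.comp (s hP hR (f ≫ g)) (L.δSelf ⟨R.obj, hR⟩ (A.t f g))) : A.IsDefect hX 0 := by
  intro P Q R T f g h hP
  have hQ := mem_of_orbitHom hX f hP
  have hR := mem_of_orbitHom hX g hQ
  have hT := mem_of_orbitHom hX h hR
  have h0 : centerVal ((0 : Cochain₃ (centerFunctor hX)) P Q R T f g h) = 1 := centerVal_zero
  rw [h0, map_one, mul_one]
  apply L.comp_δSelf_injective hX (s hP hT (f ≫ g ≫ h))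
  calc L.comp (s hP hT (f ≫ g ≫ h)) (L.δSelf ⟨T.obj, hT⟩ ((A.σ h).1 (A.t f g) * A.t (f ≫ g) h))
      = L.comp (L.comp (s hP hQ f) (s hQ hR g)) (s hR hT h) := by
        rw [hcomp hP hQ hR, assoc, δSelf_comp, ← assoc, hcomp hP hR hT, hs, assoc, δSelf_mul,
          Category.assoc]
    _ = L.comp (s hP hQ f) (L.comp (s hQ hR g) (s hR hT h)) := L.assoc _ _ _
    _ = L.comp (s hP hT (f ≫ g ≫ h))
          (L.δSelf ⟨T.obj, hT⟩ (A.t g h * A.t f (g ≫ h))) := by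
        rw [hcomp hQ hR hT, ← assoc, hcomp hP hQ hT, assoc, δSelf_mul]

theorem isObstructionCochain_zero (L : F.LinkingSystem X) (hX : F.IsClosedFamily X) :
    IsObstructionCochain hX 0 := by
  obtain ⟨A⟩ : Nonempty F.OrbitLift := inferInstance
  have h {P Q : F.OrbitCategory F.centric} (hP : P.obj ∈ X) (hQ : Q.obj ∈ X) (f : P ⟶ Q) :
      ∃ s : L.Mor ⟨P.obj, hP⟩ ⟨Q.obj, hQ⟩, L.π s = A.σ f :=
    L.π_surjective (P := ⟨P.obj, hP⟩) (Q := ⟨Q.obj, hQ⟩) (A.σ f)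
  choose s hs using @h
  obtain ⟨c, hc⟩ := L.exists_mulCenter_comp_eq hX hs
  exact isObstructionCochain_iff.mpr ⟨A.mulCenter c, L.isDefect_zero hs hc⟩

end LinkingSystem

end FusionSystem

namespace FusionSystem

variable {S : Type u} [Group S] {F : FusionSystem S} {X : Set (Subgroup S)}
  {hX : F.IsClosedFamily X}

/-! ### Linking systems from vanishing obstruction cochains -/

namespace OrbitLift

variable {A : F.OrbitLift} {P Q R T : F.OrbitCategory F.centric}

theorem IsDefect.assoc (h0 : A.IsDefect hX 0) (hP : P.obj ∈ X) (f : P ⟶ Q) (g : Q ⟶ R)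
    (h : R ⟶ T) : (A.σ h).1 (A.t f g) * A.t (f ≫ g) h = A.t g h * A.t f (g ≫ h) := by
  have hu : centerVal ((0 : Cochain₃ (centerFunctor hX)) P Q R T f g h) = 1 := centerVal_zero
  rw [h0 f g h hP, hu, map_one, mul_one]

theorem σ_id_mul (A : F.OrbitLift) (x : P.obj) :
    (A.σ (𝟙 P)).1 x * A.t (𝟙 P) (𝟙 P) = A.t (𝟙 P) (𝟙 P) * x := by
  obtain ⟨q, hq⟩ := orbitClass_eq_iff.mp ((A.orbitClass_σ (𝟙 P)).symm :
    F.orbitClass (F.homId P.obj) = F.orbitClass (A.σ (𝟙 P)))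
  obtain ⟨y, rfl⟩ : ∃ y, (A.σ (𝟙 P)).1 y = x :=
    ⟨q⁻¹ * x * q, (hq _).trans (by simp only [homId, MonoidHom.id_apply]; group)⟩
  rw [A.comm, Category.comp_id]

theorem σ_id_apply (A : F.OrbitLift) (x : P.obj) :
    (A.σ (𝟙 P)).1 x = A.t (𝟙 P) (𝟙 P) * x * (A.t (𝟙 P) (𝟙 P))⁻¹ :=
  eq_mul_inv_of_mul_eq (A.σ_id_mul x)

theorem IsDefect.t_id_left (h0 : A.IsDefect hX 0) (hP : P.obj ∈ X) (f : P ⟶ Q) :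
    A.t (𝟙 P) f = (A.σ f).1 (A.t (𝟙 P) (𝟙 P)) := by
  have h := h0.assoc hP (𝟙 P) (𝟙 P) f
  simp only [Category.id_comp] at h
  exact (mul_right_cancel h).symm

theorem IsDefect.t_id_right (h0 : A.IsDefect hX 0) (hP : P.obj ∈ X) (f : P ⟶ Q) :
    A.t f (𝟙 Q) = A.t (𝟙 Q) (𝟙 Q) := by
  have h := h0.assoc hP f (𝟙 Q) (𝟙 Q)
  simp only [Category.comp_id] at h
  have hσ := A.σ_id_mul (A.t f (𝟙 Q))
  rw [mul_right_cancel h] at hσ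
  exact (mul_left_cancel hσ).symm

/-- The composition `(r, g) ∘ (q, f) = (r · σ_g(q) · t(f, g), gf)`, where the pair `(q, f)` stands
for a morphism over `c_q ∘ σ f`. -/
def pairComp (A : F.OrbitLift) (a : Q.obj × (P ⟶ Q)) (b : R.obj × (Q ⟶ R)) :
    R.obj × (P ⟶ R) :=
  (b.1 * (A.σ b.2).1 a.1 * A.t a.2 b.2, a.2 ≫ b.2)

/-- The pair over `c_q`, so that `pairδ 1` is the identity for the composition `pairComp`. -/
def pairδ (A : F.OrbitLift) (q : P.obj) : P.obj × (P ⟶ P) :=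
  (q * (A.t (𝟙 P) (𝟙 P))⁻¹, 𝟙 P)

/-- The morphism `c_q ∘ σ f` of the fusion system which a pair `(q, f)` lies over. -/
def pairπ (A : F.OrbitLift) (a : Q.obj × (P ⟶ Q)) : F.Hom P.obj Q.obj :=
  F.homComp (A.σ a.2) (F.homConj ⟨a.1.1, mem_transporter_self a.1.2⟩)

theorem pairπ_apply (A : F.OrbitLift) (a : Q.obj × (P ⟶ Q)) (x : P.obj) :
    (A.pairπ a).1 x = a.1 * (A.σ a.2).1 x * a.1⁻¹ := rfl

theorem orbitClass_pairπ (A : F.OrbitLift) (a : Q.obj × (P ⟶ Q)) :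
    F.orbitClass (A.pairπ a) = a.2 :=
  (orbitClass_eq_iff.mpr ⟨a.1, A.pairπ_apply a⟩).symm.trans (A.orbitClass_σ a.2)

theorem pairπ_surjective (A : F.OrbitLift) :
    Function.Surjective (A.pairπ : Q.obj × (P ⟶ Q) → F.Hom P.obj Q.obj) := by
  intro φ
  obtain ⟨q, hq⟩ := orbitClass_eq_iff.mp (A.orbitClass_σ (F.orbitClass φ))
  exact ⟨(q, F.orbitClass φ), Subtype.ext (MonoidHom.ext fun x => (hq x).symm)⟩

theorem pairπ_pairComp (A : F.OrbitLift) (a : Q.obj × (P ⟶ Q)) (b : R.obj × (Q ⟶ R)) :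
    A.pairπ (A.pairComp a b) = F.homComp (A.pairπ a) (A.pairπ b) := by
  refine Subtype.ext (MonoidHom.ext fun x => ?_)
  change _ = (A.pairπ b).1 ((A.pairπ a).1 x)
  rw [pairπ_apply, pairπ_apply, pairπ_apply]
  simp only [pairComp, map_mul, map_inv, mul_inv_rev, eq_mul_inv_of_mul_eq (A.comm a.2 b.2 x),
    mul_assoc]

theorem pairπ_pairδ (A : F.OrbitLift) (q x : P.obj) : (A.pairπ (A.pairδ q)).1 x = q * x * q⁻¹ := by
  simp only [pairδ, pairπ_apply, σ_id_apply]
  group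

theorem IsDefect.pairComp_assoc (h0 : A.IsDefect hX 0) (hP : P.obj ∈ X) (a : Q.obj × (P ⟶ Q))
    (b : R.obj × (Q ⟶ R)) (c : T.obj × (R ⟶ T)) :
    A.pairComp (A.pairComp a b) c = A.pairComp a (A.pairComp b c) := by
  refine Prod.ext ?_ (Category.assoc _ _ _)
  simp only [pairComp, map_mul, mul_assoc]
  rw [h0.assoc hP, ← mul_assoc ((A.σ c.2).1 ((A.σ b.2).1 a.1)), A.comm]
  simp only [mul_assoc]

theorem IsDefect.pairδ_pairComp (h0 : A.IsDefect hX 0) (hP : P.obj ∈ X) (q : P.obj)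
    (b : Q.obj × (P ⟶ Q)) : A.pairComp (A.pairδ q) b = (b.1 * (A.σ b.2).1 q, b.2) := by
  refine Prod.ext ?_ (Category.id_comp _)
  simp only [pairComp, pairδ]
  rw [h0.t_id_left hP b.2, map_mul, map_inv, mul_assoc, inv_mul_cancel_right]

theorem IsDefect.pairComp_pairδ (h0 : A.IsDefect hX 0) (hP : P.obj ∈ X) (b : Q.obj × (P ⟶ Q))
    (q : Q.obj) : A.pairComp b (A.pairδ q) = (q * b.1, b.2) := by
  refine Prod.ext ?_ (Category.comp_id _)
  simp only [pairComp, pairδ]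
  rw [h0.t_id_right hP b.2, A.σ_id_apply]
  group

theorem IsDefect.pairδ_pairComp_comm (h0 : A.IsDefect hX 0) (hP : P.obj ∈ X) (q : P.obj)
    (b : Q.obj × (P ⟶ Q)) :
    A.pairComp (A.pairδ q) b = A.pairComp b (A.pairδ ((A.pairπ b).1 q)) := by
  rw [h0.pairδ_pairComp hP, h0.pairComp_pairδ hP, pairπ_apply, inv_mul_cancel_right]

theorem IsDefect.exists_eq_pairδ_pairComp (h0 : A.IsDefect hX 0) (hP : P.obj ∈ X)
    {a b : Q.obj × (P ⟶ Q)} (h : A.pairπ a = A.pairπ b) :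
    ∃ z ∈ Subgroup.center P.obj, b = A.pairComp (A.pairδ z) a := by
  obtain ⟨q, f⟩ := a
  obtain ⟨r, g⟩ := b
  obtain rfl : f = g := (A.orbitClass_pairπ (q, f)).symm.trans <|
    (congrArg F.orbitClass h).trans (A.orbitClass_pairπ (r, g))
  have hconj (x : P.obj) : q * (A.σ f).1 x * q⁻¹ = r * (A.σ f).1 x * r⁻¹ :=
    congrArg (fun φ : F.Hom P.obj Q.obj => φ.1 x) h
  obtain ⟨z, hz, rfl⟩ := exists_mem_center_of_conj_eq P.mem (A.σ f) (a := r) (b := q)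
    (ψ := fun x => r * (A.σ f).1 x * r⁻¹) (fun x => inv_mul_cancel_right _ _)
    (fun x => by rw [← hconj, inv_mul_cancel_right])
  exact ⟨z, hz, (h0.pairδ_pairComp hP z (q, f)).symm⟩

/-- The linking system with morphism sets `Q × Mor(P, Q)` defined by an associative lift of the
orbit category. -/
def IsDefect.toPreLinkingSystem (h0 : A.IsDefect hX 0) : F.PreLinkingSystem X where
  Mor P Q := (hX.toOrbit Q).obj × (hX.toOrbit P ⟶ hX.toOrbit Q)
  comp := A.pairComp
  assoc {P _ _ _} := h0.pairComp_assoc P.2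
  π := A.pairπ
  π_comp := A.pairπ_pairComp
  δ P := A.pairδ (P := hX.toOrbit P)
  δ_mul P a b := by
    refine ((h0.pairComp_pairδ P.2 _ _).trans ?_).symm
    exact Prod.ext (mul_assoc _ _ _).symm rfl
  one_comp {P Q} f := (h0.pairδ_pairComp P.2 1 f).trans (by rw [map_one, mul_one])
  comp_one {P Q} f := (h0.pairComp_pairδ P.2 f 1).trans (by rw [one_mul])
  π_surjective {P Q} := A.pairπ_surjective (P := hX.toOrbit P) (Q := hX.toOrbit Q)
  free {P Q} f z _ h := by
    have h1 := congrArg Prod.fst ((h0.pairδ_pairComp P.2 z f).symm.trans h)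
    exact F.injective (A.σ f.2).2 ((mul_eq_left.mp h1).trans (map_one _).symm)
  exists_of_π_eq {P Q} a b h := h0.exists_eq_pairδ_pairComp P.2 h
  π_δ P := A.pairπ_pairδ (P := hX.toOrbit P)
  δ_comp {P Q} f a := h0.pairδ_pairComp_comm P.2 a f

end OrbitLift

theorem IsObstructionCochain.nonempty_linkingClasses (hXne : X.Nonempty)
    (h : IsObstructionCochain hX 0) : Nonempty (F.LinkingClasses X) := by
  obtain ⟨A, h0⟩ := isObstructionCochain_iff.mp h
  exact ⟨(h0.toPreLinkingSystem.toLinkingSystem hXne hX).toClass⟩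

theorem exists_obstruction_class (hXne : X.Nonempty) {H : Type*} [AddCommGroup H]
    (e : BarH₃ (centerFunctor hX) ≃+ H) :
    ∃ o : H, (∃ u, IsObstructionCochain hX u) ∧
      (∀ u, IsObstructionCochain hX u →
        ∃ hu : u ∈ Cocycle₃ (centerFunctor hX), e (class₃ ⟨u, hu⟩) = o) ∧
      (Nonempty (F.LinkingClasses X) ↔ o = 0) := by
  obtain ⟨u₀, h₀⟩ := exists_isObstructionCochain hX
  refine ⟨e (class₃ ⟨u₀, h₀.mem_cocycle₃⟩), ⟨u₀, h₀⟩, fun u hu =>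
    ⟨hu.mem_cocycle₃, congrArg e (hu.class₃_eq h₀)⟩, ?_, fun h => ?_⟩
  · rintro ⟨x⟩
    obtain ⟨L, -⟩ := Quotient.exists_rep x
    rw [h₀.class₃_eq (L.isObstructionCochain_zero hX)]
    exact map_zero e
  · have h0 := h₀.zero_of_class₃_eq_zero ((map_eq_zero_iff e e.injective).mp h)
    exact h0.nonempty_linkingClasses hXne

end FusionSystem

theorem proposition1p5_general {S : Type u} [Group S] (F : FusionSystem S) (X : Set (Subgroup S))
    (hXne : X.Nonempty) (hX : F.IsClosedFamily X) :
    Nonempty (BarH₂ (centerFunctor hX) ≃+ higherLim 2 (centerFunctor hX)) ∧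
    Nonempty (BarH₃ (centerFunctor hX) ≃+ higherLim 3 (centerFunctor hX)) ∧
    (∀ e₃ : BarH₃ (centerFunctor hX) ≃+ higherLim 3 (centerFunctor hX),
      ∃ o : higherLim 3 (centerFunctor hX),
        (∃ u, IsObstructionCochain hX u) ∧
        (∀ u, IsObstructionCochain hX u →
          ∃ hu : u ∈ Cocycle₃ (centerFunctor hX), e₃ (class₃ ⟨u, hu⟩) = o) ∧
        (Nonempty (F.LinkingClasses X) ↔ o = 0)) ∧
    (Subsingleton (higherLim 3 (centerFunctor hX)) → Nonempty (F.LinkingClasses X)) ∧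
    (Nonempty (F.LinkingClasses X) →
      (∀ e₂ : BarH₂ (centerFunctor hX) ≃+ higherLim 2 (centerFunctor hX),
        ∃ act : AddAction (higherLim 2 (centerFunctor hX)) (F.LinkingClasses X),
          (∀ (z : Cocycle₂ (centerFunctor hX)) (L L' : F.LinkingSystem X),
            act.vadd (e₂ (class₂ z)) L.toClass = L'.toClass ↔ IsTwist hX z.1 L L') ∧
          (∀ (a : higherLim 2 (centerFunctor hX)) (x : F.LinkingClasses X),
            act.vadd a x = x → a = 0) ∧
          (∀ x y : F.LinkingClasses X, ∃ a : higherLim 2 (centerFunctor hX),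
            act.vadd a x = y)) ∧
      Nonempty (higherLim 2 (centerFunctor hX) ≃ F.LinkingClasses X)) := by
  have he₂ := nonempty_barH₂_addEquiv_higherLim (centerFunctor hX)
  have he₃ := nonempty_barH₃_addEquiv_higherLim (centerFunctor hX)
  refine ⟨he₂, he₃, fun e => exists_obstruction_class hXne e, fun _ => ?_,
    fun _ => ⟨fun e => exists_addAction hXne e, ?_⟩⟩
  · obtain ⟨e⟩ := he₃
    obtain ⟨o, -, -, nonempty_iff⟩ := exists_obstruction_class hXne e
    exact nonempty_iff.mpr (Subsingleton.elim _ _)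
  · obtain ⟨e⟩ := he₂
    obtain ⟨act, -, hfree, htrans⟩ := exists_addAction hXne e
    exact nonempty_equiv_of_free_of_transitive act hfree htrans

theorem proposition1p5 {p : ℕ} [Fact p.Prime] {S : Type u} [Group S] [Finite S]
    (hS : IsPGroup p S) (F : FusionSystem S) (hF : F.IsSaturated p)
    (X : Set (Subgroup S)) (hXne : X.Nonempty) (hX : F.IsClosedFamily X) :
    -- `H²` and `H³` of the bar complex are the derived functors `lim²` and `lim³`
    Nonempty (BarH₂ (centerFunctor hX) ≃+ higherLim 2 (centerFunctor hX)) ∧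
    Nonempty (BarH₃ (centerFunctor hX) ≃+ higherLim 3 (centerFunctor hX)) ∧
    -- (a), under any such identification
    (∀ e₃ : BarH₃ (centerFunctor hX) ≃+ higherLim 3 (centerFunctor hX),
      ∃ o : higherLim 3 (centerFunctor hX),
        (∃ u, IsObstructionCochain hX u) ∧
        (∀ u, IsObstructionCochain hX u →
          ∃ hu : u ∈ Cocycle₃ (centerFunctor hX), e₃ (class₃ ⟨u, hu⟩) = o) ∧
        (Nonempty (F.LinkingClasses X) ↔ o = 0)) ∧
    (Subsingleton (higherLim 3 (centerFunctor hX)) → Nonempty (F.LinkingClasses X)) ∧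
    -- (b), under any such identification
    (Nonempty (F.LinkingClasses X) →
      (∀ e₂ : BarH₂ (centerFunctor hX) ≃+ higherLim 2 (centerFunctor hX),
        ∃ act : AddAction (higherLim 2 (centerFunctor hX)) (F.LinkingClasses X),
          (∀ (z : Cocycle₂ (centerFunctor hX)) (L L' : F.LinkingSystem X),
            act.vadd (e₂ (class₂ z)) L.toClass = L'.toClass ↔ IsTwist hX z.1 L L') ∧
          (∀ (a : higherLim 2 (centerFunctor hX)) (x : F.LinkingClasses X),
            act.vadd a x = x → a = 0) ∧
          (∀ x y : F.LinkingClasses X, ∃ a : higherLim 2 (centerFunctor hX),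
            act.vadd a x = y)) ∧
      Nonempty (higherLim 2 (centerFunctor hX) ≃ F.LinkingClasses X)) :=
  proposition1p5_general F X hXne hX
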